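/- Let $k=\mathbb F_q$ be a finite field of characteristic $p>127$ with algebraic closure $\bar k$, let $f\in k[x,y,z]$ be the equation of a smooth plane quartic $C$, and let $l\in k[x,y,z]$ be a linear form with $l\cdot C=P_1^\infty+P_2^\infty+P_3^\infty+P_4^\infty$, where the points $P_i^\infty\in C(k)$ are rational and not necessarily distinct. Put $D^\infty=P_1^\infty+P_2^\infty+P_3^\infty$. Here $G\cdot C$ denotes the intersection divisor on $C(\bar k)$ of the form $G$ with $C$, a divisor is defined over $k$ if it is Galois stable, and $\mathrm{Jac}(C)(k)$ is the group of degree-zero divisors defined over $k$ modulo the divisors $G\cdot C-H\cdot C$ of rational functions $G/H$ on $C$ over $k$. Let $D^+$ be an effective divisor of degree $3$ on $C$ defined over $k$, and put $S=D^++2P_4^\infty=\sum_i m_i R_i$ with distinct points $R_i$. Consider the following algorithm (divisor inversion), which computes the inverse of $D=D^+-D^\infty$. 1. Choose $M\in \mathrm{GL}_3(k)$ such that all points $M^{-1}R_i$ lie in the patch $z\ne0$, say $M^{-1}R_i=(x_i:y_i:1)$, and put $g(x,y,z)=f(M(x,y,z))$. 2. If all $m_i\le 2$, choose a nonzero quadratic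 form $h\in k[x,y,z]$ that vanishes at all $M^{-1}R_i$ and is such that, at those with $m_i=2$, the gradient $\nabla h$ is proportional to (possibly zero times) the coefficient vector $\nabla g$ of the tangent line. Otherwise, choose $h_z\in k[X,Y]$ of degree $2$ in the ideal $\langle g(X,Y,1)\rangle+\bigcap_i\langle X-x_i,Y-y_i\rangle^{m_i}$ of $\bar k[X,Y]$, and let $h$ be its homogenization with respect to $z$. Put $Q=h(M^{-1}(x,y,z))$. 3. Compute the effective divisor $(D^{-1})^+$ with $Q\cdot C=S+(D^{-1})^+$, and return $D^{-1}=(D^{-1})^+-D^\infty$. **Lemma.** The algorithm correctly computes the negation of a divisor. Precisely: (a) steps 1 and 2 can be carried out, so that a result $Q$ exists; (b) every possible result $Q$ of step 2 is a nonzero quadratic form over $k$ with $Q\cdot C\ge S$; (c) for every nonzero quadratic form $Q\in k[x,y,z]$ with $Q\cdot C\ge D^++2P_4^\infty$ there is exactly one effective divisor $(D^{-1})^+$ with $Q\cdot C=D^++2P_4^\infty+(D^{-1})^+$. It is defined over $k$ and has degree $3$, $$(D^+-D^\infty)+((D^{-1})^+-D^\infty)=Q\cdot C-l^2\cdot C ,$$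 and the class of $(D^{-1})^+-D^\infty$ in $\mathrm{Jac}(C)(k)$ is the negative of the class of $D^+-D^\infty$. -/

import Mathlib

open MvPolynomial
open scoped LinearAlgebra.Projectivization Matrix

noncomputable section

/-! ### Plane curves, their points and divisors

`k` is the base field, `K` an algebraic closure of it. Forms have coefficients in `k`; points and
divisors are geometric, that is, they live on the curve over `K`. -/

/-- `f ∈ k[x, y, z]` is the equation of a (geometrically) smooth plane quartic. -/
def IsSmoothPlaneQuartic {k : Type*} (K : Type*) [Field k] [Field K] [Algebra k K]
    (f : MvPolynomial (Fin 3) k) : Prop :=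
  f.IsHomogeneous 4 ∧
    ∀ v : Fin 3 → K, v ≠ 0 → aeval v f = 0 → ∃ i, aeval v (pderiv i f) ≠ 0

/-- The set of geometric points of the projective plane curve `f = 0`. -/
def CurvePoint {k : Type*} (K : Type*) [Field k] [Field K] [Algebra k K]
    (f : MvPolynomial (Fin 3) k) : Type _ :=
  {P : ℙ K (Fin 3 → K) // aeval P.rep f = 0}

/-- A point of the projective plane is `k`-rational: it has homogeneous coordinates in `k`. -/
def IsRationalPoint (k : Type*) {K : Type*} [Field k] [Field K] [Algebra k K]
    (P : ℙ K (Fin 3 → K)) : Prop :=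
  ∃ (v : Fin 3 → k) (hv : (fun i => algebraMap k K (v i)) ≠ 0),
    P = Projectivization.mk K (fun i => algebraMap k K (v i)) hv

theorem conj_rep_ne_zero {k K : Type*} [Field k] [Field K] [Algebra k K] (σ : K ≃ₐ[k] K)
    (P : ℙ K (Fin 3 → K)) : (fun i => σ (P.rep i)) ≠ 0 := by
  intro h
  apply P.rep_nonzero
  funext i
  have hi := congrFun h i
  simpa using hi

/-- The Galois conjugate of a point of the projective plane. -/
def galConj {k K : Type*} [Field k] [Field K] [Algebra k K] (σ : K ≃ₐ[k] K)
    (P : ℙ K (Fin 3 → K)) : ℙ K (Fin 3 → K) :=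
  Projectivization.mk K (fun i => σ (P.rep i)) (conj_rep_ne_zero σ P)

/-- A divisor on the curve (with coefficients in `M = ℕ` or `M = ℤ`) is defined over `k`:
conjugate points have the same coefficient. -/
def GaloisStable {k K : Type*} [Field k] [Field K] [Algebra k K] {f : MvPolynomial (Fin 3) k}
    {M : Type*} [Zero M] (D : CurvePoint K f →₀ M) : Prop :=
  ∀ (σ : K ≃ₐ[k] K) (P P' : CurvePoint K f), P'.1 = galConj σ P.1 → D P = D P'

/-- An effective divisor, as a divisor with integer coefficients. -/
def toDiv {k K : Type*} [Field k] [Field K] [Algebra k K] {f : MvPolynomial (Fin 3) k}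
    (D : CurvePoint K f →₀ ℕ) : CurvePoint K f →₀ ℤ :=
  D.mapRange (fun n : ℕ => (n : ℤ)) Nat.cast_zero

/-! ### Intersection multiplicities and intersection divisors -/

/-- A coordinate which does not vanish at `P`. -/
def chart {K : Type*} [Field K] (P : ℙ K (Fin 3 → K)) : Fin 3 :=
  (Function.ne_iff.mp P.rep_nonzero).choose

/-- The dehomogenization of `F` in the chart `x_i = 1`. -/
def dehom {K : Type*} [Field K] (i : Fin 3) (F : MvPolynomial (Fin 3) K) :
    MvPolynomial (Fin 2) K :=
  aeval (i.insertNth (α := fun _ => MvPolynomial (Fin 2) K) 1 X) F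

/-- The affine coordinates of `P` in its chart. -/
def affineCoords {K : Type*} [Field K] (P : ℙ K (Fin 3 → K)) : Fin 2 → K :=
  fun j => P.rep ((chart P).succAbove j) / P.rep (chart P)

/-- The ideal of an affine point; it is prime (indeed maximal). -/
abbrev pointIdeal {K : Type*} [Field K] (a : Fin 2 → K) : Ideal (MvPolynomial (Fin 2) K) :=
  RingHom.ker (eval a)

instance pointIdeal_isPrime {K : Type*} [Field K] (a : Fin 2 → K) : (pointIdeal a).IsPrime :=
  RingHom.ker_isPrime (eval a)

/-- The local ring of the affine plane at the point `a`. -/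
abbrev LocalRingAt {K : Type*} [Field K] (a : Fin 2 → K) : Type _ :=
  Localization.AtPrime (pointIdeal a)

/-- The intersection multiplicity of `F = 0` and `G = 0` at the point `P` of the projective plane:
the dimension over `K` of `𝒪_P / (F, G)`, where `𝒪_P` is the local ring of the plane at `P`. It is
`⊤` when this dimension is infinite. -/
def interMult {K : Type*} [Field K] (F G : MvPolynomial (Fin 3) K) (P : ℙ K (Fin 3 → K)) : ℕ∞ :=
  Module.length K (LocalRingAt (affineCoords P) ⧸
    Ideal.map (algebraMap (MvPolynomial (Fin 2) K) (LocalRingAt (affineCoords P)))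
      (Ideal.span {dehom (chart P) F, dehom (chart P) G}))

/-- The multiplicity at `P` of the intersection of the curve `C : f = 0` with `G = 0`. -/
def multAt {k K : Type*} [Field k] [Field K] [Algebra k K] (f G : MvPolynomial (Fin 3) k)
    (P : CurvePoint K f) : ℕ∞ :=
  interMult (map (algebraMap k K) f) (map (algebraMap k K) G) P.1

/-- `G · C = A`, where `C` is the curve `f = 0`. (In particular all multiplicities are finite, so
that `G` does not vanish identically on a component of `C`.) -/
def InterEq {k K : Type*} [Field k] [Field K] [Algebra k K] (f G : MvPolynomial (Fin 3) k)
    (A : CurvePoint K f →₀ ℕ) : Prop :=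
  ∀ P, multAt f G P = (A P : ℕ∞)

/-- `G · C ≥ S`, where `C` is the curve `f = 0`. -/
def InterGe {k K : Type*} [Field k] [Field K] [Algebra k K] (f G : MvPolynomial (Fin 3) k)
    (S : CurvePoint K f →₀ ℕ) : Prop :=
  ∀ P, (S P : ℕ∞) ≤ multAt f G P

/-! ### The Jacobian -/

/-- The divisors of degree zero that are defined over `k`. -/
def ratDivZero {k : Type*} (K : Type*) [Field k] [Field K] [Algebra k K]
    (f : MvPolynomial (Fin 3) k) : AddSubgroup (CurvePoint K f →₀ ℤ) where
  carrier := {D | GaloisStable D ∧ D.degree = 0}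
  zero_mem' := ⟨fun _ _ _ _ => rfl, map_zero _⟩
  add_mem' := by
    rintro a b ⟨ha, ha'⟩ ⟨hb, hb'⟩
    refine ⟨fun σ P P' h => ?_, ?_⟩
    · rw [Finsupp.add_apply, Finsupp.add_apply, ha σ P P' h, hb σ P P' h]
    · rw [map_add, ha', hb', add_zero]
  neg_mem' := by
    rintro a ⟨ha, ha'⟩
    refine ⟨fun σ P P' h => ?_, ?_⟩
    · rw [Finsupp.neg_apply, Finsupp.neg_apply, ha σ P P' h]
    · rw [map_neg, ha', neg_zero]

/-- The principal divisors over `k`. A rational function on `C` defined over `k` is a quotient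
`G / H` of two forms of the same degree which do not vanish identically on `C`, and its divisor is
`G · C - H · C`. (The divisors of this shape are closed under addition already, since rational
functions can be multiplied.) -/
def principalDivisors {k : Type*} (K : Type*) [Field k] [Field K] [Algebra k K]
    (f : MvPolynomial (Fin 3) k) : AddSubgroup (CurvePoint K f →₀ ℤ) :=
  AddSubgroup.closure {D | ∃ (d : ℕ) (G H : MvPolynomial (Fin 3) k)
    (A B : CurvePoint K f →₀ ℕ), G.IsHomogeneous d ∧ H.IsHomogeneous d ∧
      InterEq f G A ∧ InterEq f H B ∧ D = toDiv A - toDiv B}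

/-- The group `Jac(C)(k)` of the curve `C : f = 0`, as the group of divisors of degree zero defined
over `k` modulo the divisors of the rational functions defined over `k`. (This is `Jac(C)(k)` if `k`
is finite, or if `C` has a `k`-rational point.) -/
abbrev Jac {k : Type*} (K : Type*) [Field k] [Field K] [Algebra k K]
    (f : MvPolynomial (Fin 3) k) : Type _ :=
  ratDivZero K f ⧸ (principalDivisors K f).addSubgroupOf (ratDivZero K f)

/-- The class of a divisor in `Jac(C)(k)`. -/
def Jac.mk {k K : Type*} [Field k] [Field K] [Algebra k K] {f : MvPolynomial (Fin 3) k}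
    (D : CurvePoint K f →₀ ℤ) (hD : D ∈ ratDivZero K f) : Jac K f :=
  QuotientAddGroup.mk (⟨D, hD⟩ : ratDivZero K f)

/-! ### The interpolation step of the inversion algorithm -/

/-- `F(M x)`, the form `F` after the linear change of variables `M`. -/
def linSubst {k : Type*} [Field k] (M : Matrix (Fin 3) (Fin 3) k) (F : MvPolynomial (Fin 3) k) :
    MvPolynomial (Fin 3) k :=
  bind₁ (fun i => ∑ j, C (M i j) * X j) F

/-- Homogeneous coordinates of the point `P` after the change of variables, that is, of `M⁻¹ P`. -/
def newCoords {k K : Type*} [Field k] [Field K] [Algebra k K] (M : Matrix (Fin 3) (Fin 3) k)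
    (P : ℙ K (Fin 3 → K)) : Fin 3 → K :=
  (M⁻¹.map (algebraMap k K)) *ᵥ P.rep

/-- Interpolation by linear algebra, in the new coordinates: `q` is a nonzero quadratic form that
vanishes at the points of `S`, and at the points of multiplicity `2` its gradient is proportional to
the coefficient vector of the tangent line of the curve. -/
def LinAlgInterpolation {k K : Type*} [Field k] [Field K] [Algebra k K]
    (f : MvPolynomial (Fin 3) k) (S : CurvePoint K f →₀ ℕ) (M : Matrix (Fin 3) (Fin 3) k)
    (q : MvPolynomial (Fin 3) k) : Prop :=
  q.IsHomogeneous 2 ∧ q ≠ 0 ∧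
    ∀ P ∈ S.support, aeval (newCoords M P.1) q = 0 ∧
      (S P = 2 → ∀ i j : Fin 3,
        aeval (newCoords M P.1) (pderiv i q) * aeval (newCoords M P.1) (pderiv j (linSubst M f)) -
        aeval (newCoords M P.1) (pderiv j q) * aeval (newCoords M P.1) (pderiv i (linSubst M f)) = 0)

/-- The ideal `⟨g_z⟩ + ⋂ ⟨X - x_i, Y - y_i⟩ ^ m_i` of the ideal interpolation, where `g_z` is the
equation of the curve in the new coordinates on the patch `z = 1`, and `(x_i, y_i)` and `m_i` are
the points of `S` on that patch and their multiplicities. -/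
def interpolationIdeal {k K : Type*} [Field k] [Field K] [Algebra k K]
    (f : MvPolynomial (Fin 3) k) (S : CurvePoint K f →₀ ℕ) (M : Matrix (Fin 3) (Fin 3) k) :
    Ideal (MvPolynomial (Fin 2) K) :=
  Ideal.span {dehom 2 (map (algebraMap k K) (linSubst M f))} ⊔
    ⨅ P ∈ S.support,
      Ideal.span {X 0 - C (newCoords M P.1 0 / newCoords M P.1 2),
        X 1 - C (newCoords M P.1 1 / newCoords M P.1 2)} ^ (S P)

/-- Interpolation by ideals, in the new coordinates: `q` is the homogenization of a polynomial of
degree `2` in the interpolation ideal. -/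
def IdealInterpolation {k K : Type*} [Field k] [Field K] [Algebra k K]
    (f : MvPolynomial (Fin 3) k) (S : CurvePoint K f →₀ ℕ) (M : Matrix (Fin 3) (Fin 3) k)
    (q : MvPolynomial (Fin 3) k) : Prop :=
  q.IsHomogeneous 2 ∧ (dehom 2 q).totalDegree = 2 ∧
    dehom 2 (map (algebraMap k K) q) ∈ interpolationIdeal f S M

/-- `Q` is a possible result of the interpolation step for the divisor `S`: after some linear change
of variables `M` over `k` that moves all points of `S` to the patch `z ≠ 0`, the method of linear
algebra (if all multiplicities are at most `2`) or the method of ideals (otherwise) may return the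
form `q`, and `Q` is `q` in the original coordinates. -/
def IsInterpolationResult {k K : Type*} [Field k] [Field K] [Algebra k K]
    (f : MvPolynomial (Fin 3) k) (S : CurvePoint K f →₀ ℕ) (Q : MvPolynomial (Fin 3) k) : Prop :=
  ∃ M : Matrix (Fin 3) (Fin 3) k, IsUnit M.det ∧ (∀ P ∈ S.support, newCoords M P.1 2 ≠ 0) ∧
    ∃ q : MvPolynomial (Fin 3) k, Q = linSubst M⁻¹ q ∧
      (((∀ P, S P ≤ 2) ∧ LinAlgInterpolation f S M q) ∨
        ((¬ ∀ P, S P ≤ 2) ∧ IdealInterpolation f S M q))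

end

/-!
Write `F` for the equation `f` of the curve over the algebraic closure `K`, and `m` for the ideal of
a point `P` of the curve in its local ring `𝒪`.

*Multiplicities.* Since the curve is smooth, `𝒪 / (F)` is a discrete valuation ring with residue
field `K`, so that `G · C` has multiplicity at least `n` at `P` if and only if `G ∈ (F) + m ^ n`
(`IsSmoothGerm.le_length_iff`), and multiplicities are additive in `G`. The condition `MultGe`
expresses the same fact by forms, without choosing a chart (`le_localMult_dehom_iff`). In this shape
it is visibly compatible with linear changes of coordinates and with Galois conjugation, and it can
be compared with what the two interpolation methods compute: for `n = 2` it says that `G` vanishes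
at `P` and has a gradient proportional to that of `F` (`multGe_two`,
`MultGe.gradient_proportional`), and in the chart `z = 1` the conditions at the points of `S`
combine into membership in the interpolation ideal, by the Chinese remainder theorem
(`mem_sup_iInf_of_forall_mem_sup`).

*Bézout's theorem* (`sum_interMult`). A form `G` of degree `n` smaller than the degree `m` of `F`
has no factor in common with `F`: another factor of `F` would meet a common factor, in a singular
point of the curve (`isRelPrime_of_smooth`). Counting dimensions in the graded ring
`K[x, y, z] / (F, G)` then gives `m n` in large degrees (`finrank_idealForms_add`). After a change
of coordinates the line `z = 0` avoids the common zeros. Then `z` is not a zero divisor on this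
ring, hence the coordinate ring of the affine part has dimension `m n` as well
(`finrank_affineInter`). It is the product of its localizations (`length_quotient_eq_sum`), whose
dimensions are the intersection multiplicities.

*Existence of the interpolating quadric.* The divisor `S` has degree `5` and imposes at most `5`
linear conditions on the space of quadratic forms over `K`, which has dimension `6`
(`IsSmoothPlaneQuartic.exists_form_multGe`). The space of solutions is Galois stable, because `S`
is, hence it contains a nonzero form over `k` (`exists_map_mem_of_stable`). The field is large
enough for a line over `k` that avoids the points of `S` (`exists_line_avoiding`). Moving this line
to `z = 0`, the quadric keeps its degree after dehomogenization: otherwise it contains the line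
`z = 0`, and the other line would meet the quartic in a divisor of degree `4` containing `S`, which
has degree `5` (`IsSmoothPlaneQuartic.totalDegree_dehom_eq_two`).

*The residual divisor.* By Bézout's theorem `Q · C` has degree `8`, so `Q · C - S` is effective of
degree `3`. It is Galois stable as `Q · C` and `S` are, and the identity of divisors follows
from `l ^ 2 · C = 2 D^∞ + 2 P₄^∞`; the right hand side is the divisor of the function `Q / l ^ 2`.
-/

noncomputable section

/-! ### Lengths in a one-dimensional regular local ring -/

section LocalRing

variable {K A : Type*} [Field K] [CommRing A] [Algebra K A]

open scoped Pointwise in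
theorem length_quotient_mul (x : A) {y : A} (hy : y ∈ nonZeroDivisors A) :
    Module.length K (A ⧸ Ideal.span {x * y}) =
      Module.length K (A ⧸ Ideal.span {x}) + Module.length K (A ⧸ Ideal.span {y}) := by
  have h := Module.length_eq_add_of_exact
    ((Ideal.mulQuot y (Ideal.span {x})).restrictScalars K)
    ((Ideal.quotOfMul y (Ideal.span {x})).restrictScalars K)
    (Ideal.mulQuot_injective (Ideal.span {x}) hy)
    (Ideal.quotOfMul_surjective (Ideal.span {x}))
    (Ideal.exact_mulQuot_quotOfMul (Ideal.span {x}))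
  have e : (y • Ideal.span {x} : Ideal A) = Ideal.span {x * y} := by
    rw [← Submodule.singleton_set_smul, ← Ideal.submodule_span_eq, Submodule.set_smul_span]
    simp [mul_comm]
  rw [e] at h
  exact h

theorem length_quotient_le_of_le {I J : Ideal A} (h : I ≤ J) :
    Module.length K (A ⧸ J) ≤ Module.length K (A ⧸ I) :=
  Module.length_le_of_surjective (Ideal.Quotient.factorₐ K h).toLinearMap
    (Ideal.Quotient.factor_surjective h)

variable [IsLocalRing A] {t : A}

theorem length_quotient_uniformizer (ht : IsLocalRing.maximalIdeal A = Ideal.span {t})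
    (hK : ∀ x : A, ∃ c : K, x - algebraMap K A c ∈ IsLocalRing.maximalIdeal A) :
    Module.length K (A ⧸ Ideal.span {t}) = 1 := by
  rw [← ht]
  have hb : Function.Bijective (Algebra.linearMap K (A ⧸ IsLocalRing.maximalIdeal A)) := by
    refine ⟨(algebraMap K (A ⧸ IsLocalRing.maximalIdeal A)).injective, fun y => ?_⟩
    obtain ⟨x, rfl⟩ := Ideal.Quotient.mk_surjective y
    obtain ⟨c, hc⟩ := hK x
    refine ⟨c, ?_⟩
    symm
    exact (Ideal.Quotient.eq).mpr hc
  rw [← (LinearEquiv.ofBijective _ hb).length_eq]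
  exact Module.length_eq_one _ _

variable [IsNoetherianRing A]

/-- By Krull's intersection theorem, every nonzero element has a finite order with respect to a
generator of the maximal ideal. -/
theorem exists_unit_mul_pow (ht : IsLocalRing.maximalIdeal A = Ideal.span {t}) {x : A}
    (hx : x ≠ 0) : ∃ (n : ℕ) (u : Aˣ), x = u * t ^ n := by
  have hK : ⨅ i : ℕ, (IsLocalRing.maximalIdeal A) ^ i = ⊥ :=
    Ideal.iInf_pow_eq_bot_of_isLocalRing _ Ideal.IsPrime.ne_top'
  have : ∃ n, x ∉ (IsLocalRing.maximalIdeal A) ^ n := by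
    by_contra! h
    exact hx (by rw [← Ideal.mem_bot, ← hK]; exact (Ideal.mem_iInf).mpr h)
  classical
  have h0 : Nat.find this ≠ 0 := by
    intro h
    have := Nat.find_spec this
    simp [h] at this
  obtain ⟨m, hm⟩ := Nat.exists_eq_succ_of_ne_zero h0
  have h1 : x ∈ (IsLocalRing.maximalIdeal A) ^ m := by
    by_contra hc
    have := Nat.find_min' this hc
    omega
  have h2 := Nat.find_spec this
  rw [hm] at h2
  rw [ht, Ideal.span_singleton_pow, Ideal.mem_span_singleton] at h1 h2
  obtain ⟨u, rfl⟩ := h1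
  have hu : IsUnit u := by
    by_contra hu
    have : u ∈ IsLocalRing.maximalIdeal A := hu
    rw [ht, Ideal.mem_span_singleton] at this
    obtain ⟨w, rfl⟩ := this
    exact h2 ⟨w, by rw [pow_succ]; ring⟩
  exact ⟨m, hu.unit, by rw [IsUnit.unit_spec, mul_comm]⟩

theorem isDomain_of_maximalIdeal_eq_span (ht : IsLocalRing.maximalIdeal A = Ideal.span {t})
    (hn : ¬ IsNilpotent t) : IsDomain A := by
  have : NoZeroDivisors A := ⟨by
    intro x y hxy
    by_contra! h
    obtain ⟨n, u, rfl⟩ := exists_unit_mul_pow ht h.1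
    obtain ⟨m, w, rfl⟩ := exists_unit_mul_pow ht h.2
    refine hn ⟨n + m, ?_⟩
    have : ((u * w : Aˣ) : A) * t ^ (n + m) = 0 := by
      rw [← hxy, Units.val_mul, pow_add]; ring
    exact (Units.mul_right_eq_zero _).mp this⟩
  exact NoZeroDivisors.to_isDomain A

theorem length_quotient_uniformizer_pow (ht : IsLocalRing.maximalIdeal A = Ideal.span {t})
    (hn : ¬ IsNilpotent t)
    (hK : ∀ x : A, ∃ c : K, x - algebraMap K A c ∈ IsLocalRing.maximalIdeal A) (n : ℕ) :
    Module.length K (A ⧸ Ideal.span {t ^ n}) = n := by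
  have := isDomain_of_maximalIdeal_eq_span ht hn
  have h0 : t ≠ 0 := fun h => hn (h ▸ IsNilpotent.zero)
  induction n with
  | zero =>
    rw [pow_zero, Ideal.span_singleton_one]
    simp
  | succ n ih =>
    rw [pow_succ, length_quotient_mul _ (mem_nonZeroDivisors_of_ne_zero h0), ih,
      length_quotient_uniformizer ht hK]
    simp

/-- The ring `A` is a discrete valuation ring with residue field `K`, and the dimension of `A / (x)`
is the valuation of `x`. -/
theorem le_length_quotient_iff (ht : IsLocalRing.maximalIdeal A = Ideal.span {t})
    (hn : ¬ IsNilpotent t)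
    (hK : ∀ x : A, ∃ c : K, x - algebraMap K A c ∈ IsLocalRing.maximalIdeal A) (n : ℕ) (x : A) :
    (n : ℕ∞) ≤ Module.length K (A ⧸ Ideal.span {x}) ↔ x ∈ (IsLocalRing.maximalIdeal A) ^ n := by
  have := isDomain_of_maximalIdeal_eq_span ht hn
  have h0 : t ≠ 0 := fun h => hn (h ▸ IsNilpotent.zero)
  have htu : ¬ IsUnit t := by
    have : t ∈ IsLocalRing.maximalIdeal A := by rw [ht]; exact Ideal.mem_span_singleton_self t
    exact this
  rw [ht, Ideal.span_singleton_pow]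
  constructor
  · intro h
    by_cases hx : x = 0
    · rw [hx]; exact Ideal.zero_mem _
    obtain ⟨m, u, rfl⟩ := exists_unit_mul_pow ht hx
    rw [Ideal.span_singleton_mul_left_unit u.isUnit,
      length_quotient_uniformizer_pow ht hn hK] at h
    exact Ideal.mul_mem_left _ _ (Ideal.mem_span_singleton.mpr (pow_dvd_pow t (by exact_mod_cast h)))
  · intro h
    rw [← length_quotient_uniformizer_pow ht hn hK n]
    exact length_quotient_le_of_le ((Ideal.span_singleton_le_iff_mem _).mpr h)

theorem length_quotient_mul_of_maximalIdeal_eq_span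
    (ht : IsLocalRing.maximalIdeal A = Ideal.span {t}) (hn : ¬ IsNilpotent t)
    (hK : ∀ x : A, ∃ c : K, x - algebraMap K A c ∈ IsLocalRing.maximalIdeal A) (x y : A) :
    Module.length K (A ⧸ Ideal.span {x * y}) =
      Module.length K (A ⧸ Ideal.span {x}) + Module.length K (A ⧸ Ideal.span {y}) := by
  have := isDomain_of_maximalIdeal_eq_span ht hn
  by_cases hy : y = 0
  · have h : Module.length K (A ⧸ Ideal.span {y}) = ⊤ :=
      ENat.eq_top_iff_forall_ge.mpr fun n => (le_length_quotient_iff ht hn hK n y).mpr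
        (by rw [hy]; exact Ideal.zero_mem _)
    rw [h, add_top, ← h, hy, mul_zero]
  · exact length_quotient_mul x (mem_nonZeroDivisors_of_ne_zero hy)

end LocalRing

/-! ### Smooth curve germs -/

section SmoothGerm

variable {K O : Type*} [Field K] [CommRing O] [Algebra K O] [IsLocalRing O] [IsNoetherianRing O]

/-- `x = 0` is a smooth curve germ in `Spec O`, with local parameter `t`: modulo the square of the
maximal ideal, `x` and `t` generate it, and no power of `t` vanishes on the germ. The residue field
is assumed to be `K`. -/
structure IsSmoothGerm (K : Type*) {O : Type*} [Field K] [CommRing O] [Algebra K O] [IsLocalRing O]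
    (x t : O) : Prop where
  mem : x ∈ IsLocalRing.maximalIdeal O
  param_mem : t ∈ IsLocalRing.maximalIdeal O
  le_span : IsLocalRing.maximalIdeal O ≤ Ideal.span {x, t} ⊔ IsLocalRing.maximalIdeal O ^ 2
  pow_notMem : ∀ n : ℕ, t ^ n ∉ Ideal.span {x}
  residue : ∀ y : O, ∃ c : K, y - algebraMap K O c ∈ IsLocalRing.maximalIdeal O

namespace IsSmoothGerm

variable {x t : O} (h : IsSmoothGerm K x t)

include h

omit [IsNoetherianRing O] in
theorem isLocalRing : IsLocalRing (O ⧸ Ideal.span {x}) := by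
  have : Nontrivial (O ⧸ Ideal.span {x}) := by
    rw [Ideal.Quotient.nontrivial_iff, Ne, Ideal.span_singleton_eq_top]
    exact h.mem
  exact IsLocalRing.of_surjective' _ Ideal.Quotient.mk_surjective

omit [IsNoetherianRing O] h in
theorem maximalIdeal_quotient [IsLocalRing (O ⧸ Ideal.span {x})] :
    IsLocalRing.maximalIdeal (O ⧸ Ideal.span {x}) =
      (IsLocalRing.maximalIdeal O).map (Ideal.Quotient.mk (Ideal.span {x})) :=
  (IsLocalRing.map_maximalIdeal_of_surjective _ Ideal.Quotient.mk_surjective).symm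

/-- By Nakayama's lemma, the parameter generates the maximal ideal of the germ. -/
theorem maximalIdeal_eq_span [IsLocalRing (O ⧸ Ideal.span {x})] :
    IsLocalRing.maximalIdeal (O ⧸ Ideal.span {x}) =
      Ideal.span {Ideal.Quotient.mk (Ideal.span {x}) t} := by
  have h3 := Ideal.map_mono (f := Ideal.Quotient.mk (Ideal.span {x})) h.le_span
  have h0 : Ideal.Quotient.mk (Ideal.span {x}) x = 0 :=
    (Ideal.Quotient.eq_zero_iff_mem).mpr (Ideal.mem_span_singleton_self _)
  rw [Ideal.map_sup, Ideal.map_pow, ← maximalIdeal_quotient, Ideal.map_span, Set.image_pair, h0,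
    Ideal.span_insert_zero] at h3
  apply le_antisymm
  · apply Submodule.le_of_le_smul_of_le_jacobson_bot (I := IsLocalRing.maximalIdeal _)
      (IsNoetherian.noetherian _) (IsLocalRing.maximalIdeal_le_jacobson _)
    rwa [smul_eq_mul, ← pow_two]
  · rw [Ideal.span_singleton_le_iff_mem, maximalIdeal_quotient]
    exact Ideal.mem_map_of_mem _ h.param_mem

omit [IsNoetherianRing O] in
theorem not_isNilpotent : ¬ IsNilpotent (Ideal.Quotient.mk (Ideal.span {x}) t) := by
  rintro ⟨n, hn⟩
  rw [← map_pow] at hn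
  exact h.pow_notMem n ((Ideal.Quotient.eq_zero_iff_mem).mp hn)

omit [IsNoetherianRing O] in
theorem residue_quotient [IsLocalRing (O ⧸ Ideal.span {x})] (y : O ⧸ Ideal.span {x}) :
    ∃ c : K, y - algebraMap K _ c ∈ IsLocalRing.maximalIdeal (O ⧸ Ideal.span {x}) := by
  obtain ⟨y, rfl⟩ := Ideal.Quotient.mk_surjective y
  obtain ⟨c, hc⟩ := h.residue y
  exact ⟨c, by rw [maximalIdeal_quotient]; exact Ideal.mem_map_of_mem _ hc⟩

omit [IsLocalRing O] [IsNoetherianRing O] h in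
theorem length_quotient_pair (x y : O) :
    Module.length K (O ⧸ Ideal.span {x, y}) =
      Module.length K ((O ⧸ Ideal.span {x}) ⧸
        Ideal.span {Ideal.Quotient.mk (Ideal.span {x}) y}) := by
  have h1 := (DoubleQuot.quotQuotEquivQuotSupₐ K (Ideal.span {x})
    (Ideal.span {y})).toLinearEquiv.length_eq
  rw [Ideal.map_span, Set.image_singleton] at h1
  rw [Ideal.span_insert]
  exact h1.symm

theorem le_length_iff (n : ℕ) (y : O) :
    (n : ℕ∞) ≤ Module.length K (O ⧸ Ideal.span {x, y}) ↔
      y ∈ Ideal.span {x} ⊔ IsLocalRing.maximalIdeal O ^ n := by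
  have := h.isLocalRing
  rw [length_quotient_pair,
    le_length_quotient_iff h.maximalIdeal_eq_span h.not_isNilpotent h.residue_quotient,
    maximalIdeal_quotient, ← Ideal.map_pow, ← Ideal.mem_comap,
    Ideal.comap_map_of_surjective _ Ideal.Quotient.mk_surjective, sup_comm]
  have : Ideal.comap (Ideal.Quotient.mk (Ideal.span {x})) ⊥ = Ideal.span {x} := Ideal.mk_ker
  rw [this]

theorem length_mul (y z : O) :
    Module.length K (O ⧸ Ideal.span {x, y * z}) =
      Module.length K (O ⧸ Ideal.span {x, y}) + Module.length K (O ⧸ Ideal.span {x, z}) := by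
  have := h.isLocalRing
  rw [length_quotient_pair, length_quotient_pair, length_quotient_pair,
    show Ideal.Quotient.mk (Ideal.span {x}) (y * z) = _ * _ from
      map_mul (Ideal.Quotient.mk (Ideal.span {x})) y z]
  exact length_quotient_mul_of_maximalIdeal_eq_span h.maximalIdeal_eq_span h.not_isNilpotent
    h.residue_quotient _ _

theorem length_sup_pow (n : ℕ) :
    Module.length K (O ⧸ Ideal.span {x} ⊔ IsLocalRing.maximalIdeal O ^ n) = n := by
  have := h.isLocalRing
  rw [← length_quotient_uniformizer_pow (K := K) h.maximalIdeal_eq_span h.not_isNilpotent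
    h.residue_quotient n, ← Ideal.span_singleton_pow, ← h.maximalIdeal_eq_span,
    maximalIdeal_quotient, ← Ideal.map_pow]
  exact (DoubleQuot.quotQuotEquivQuotSupₐ K _ _).toLinearEquiv.length_eq.symm

end IsSmoothGerm

end SmoothGerm

/-! ### Intersection multiplicities at a smooth point of an affine plane curve -/

/-- Two polynomial evaluations which agree modulo an ideal on the variables agree modulo it. -/
theorem aeval_sub_aeval_mem {σ K T : Type*} [CommRing K] [CommRing T] [Algebra K T] (I : Ideal T)
    (x y : σ → T) (h : ∀ i, x i - y i ∈ I) (p : MvPolynomial σ K) :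
    aeval x p - aeval y p ∈ I := by
  rw [← Ideal.Quotient.eq]
  have : ∀ z : σ → T, Ideal.Quotient.mk I (aeval z p) =
      aeval (fun i => Ideal.Quotient.mk I (z i)) p := fun z => by
    rw [← Ideal.Quotient.mkₐ_eq_mk K, ← AlgHom.comp_apply, comp_aeval]
  rw [this, this, funext fun i => (Ideal.Quotient.eq).mpr (h i)]

section AffinePlane

variable {K : Type*} [Field K] {a : Fin 2 → K}

/-- Taylor's formula up to terms of order two. -/
theorem taylor_mem {σ : Type*} [Fintype σ] (a : σ → K) (h : MvPolynomial σ K) :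
    h - C (eval a h) - ∑ j, C (eval a (pderiv j h)) * (X j - C (a j)) ∈
      Ideal.span (Set.range fun j => (X j - C (a j) : MvPolynomial σ K)) ^ 2 := by
  classical
  set J := Ideal.span (Set.range fun j => (X j - C (a j) : MvPolynomial σ K)) with hJ
  have hX : ∀ j, (X j - C (a j) : MvPolynomial σ K) ∈ J := fun j =>
    Ideal.subset_span ⟨j, rfl⟩
  induction h using MvPolynomial.induction_on with
  | C c => simp
  | add p q hp hq =>
    convert! Ideal.add_mem _ hp hq using 1
    simp only [map_add, add_mul, Finset.sum_add_distrib]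
    ring
  | mul_X p i hp =>
    have hL : ∑ j, C (eval a (pderiv j p)) * (X j - C (a j)) ∈ J :=
      Ideal.sum_mem _ fun j _ => Ideal.mul_mem_left _ _ (hX j)
    have h2 : (∑ j, C (eval a (pderiv j p)) * (X j - C (a j))) * (X i - C (a i)) ∈ J ^ 2 := by
      rw [pow_two]; exact Ideal.mul_mem_mul hL (hX i)
    convert! Ideal.add_mem _ (Ideal.mul_mem_left _ (X i) hp) h2 using 1
    have e : ∑ j, C (eval a (pderiv j (p * X i))) * (X j - C (a j)) =
        C (a i) * ∑ j, C (eval a (pderiv j p)) * (X j - C (a j)) +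
          C (eval a p) * (X i - C (a i)) := by
      have : ∀ j, C (eval a (pderiv j (p * X i))) * (X j - C (a j)) =
          C (a i) * (C (eval a (pderiv j p)) * (X j - C (a j))) +
            if j = i then C (eval a p) * (X i - C (a i)) else 0 := by
        intro j
        rw [pderiv_mul]
        split_ifs with hji
        · subst hji
          simp
          ring
        · rw [pderiv_X_of_ne (Ne.symm hji)]
          simp
          ring
      simp_rw [this, Finset.sum_add_distrib, Finset.mul_sum]
      simp
    rw [e]
    simp
    ring

theorem pointIdeal_eq_span (a : Fin 2 → K) :
    pointIdeal a = Ideal.span (Set.range fun j => (X j - C (a j) : MvPolynomial (Fin 2) K)) := by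
  apply le_antisymm
  · intro h hh
    have hh' : eval a h = 0 := hh
    have h1 := Ideal.pow_le_self two_ne_zero (taylor_mem a h)
    rw [hh', C_0, sub_zero] at h1
    exact (Submodule.sub_mem_iff_left _ (Ideal.sum_mem _ fun j _ =>
      Ideal.mul_mem_left _ _ (Ideal.subset_span (Set.mem_range_self j)))).mp h1
  · rw [Ideal.span_le]
    rintro _ ⟨j, rfl⟩
    simp [RingHom.mem_ker]

theorem mem_pointIdeal_sq {h : MvPolynomial (Fin 2) K} (h0 : eval a h = 0)
    (h1 : ∀ j, eval a (pderiv j h) = 0) : h ∈ pointIdeal a ^ 2 := by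
  have := taylor_mem a h
  rw [← pointIdeal_eq_span] at this
  simpa [h0, h1] using this

/-- The intersection multiplicity of two affine plane curves at a point. -/
def localMult (F G : MvPolynomial (Fin 2) K) (a : Fin 2 → K) : ℕ∞ :=
  Module.length K (LocalRingAt a ⧸
    Ideal.map (algebraMap (MvPolynomial (Fin 2) K) (LocalRingAt a)) (Ideal.span {F, G}))

theorem localMult_eq (F G : MvPolynomial (Fin 2) K) (a : Fin 2 → K) :
    localMult F G a = Module.length K (LocalRingAt a ⧸
      Ideal.span {algebraMap (MvPolynomial (Fin 2) K) (LocalRingAt a) F,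
        algebraMap (MvPolynomial (Fin 2) K) (LocalRingAt a) G}) := by
  rw [localMult, Ideal.map_span, Set.image_pair]

/-- Substituting `c` for `X j` changes a polynomial by a multiple of `X j - c`. -/
theorem sub_subst_mem {σ : Type*} [DecidableEq σ] (j : σ) (c : K) (p : MvPolynomial σ K) :
    p - aeval (Function.update X j (C c)) p ∈
      Ideal.span {(X j - C c : MvPolynomial σ K)} := by
  have := aeval_sub_aeval_mem (Ideal.span {(X j - C c : MvPolynomial σ K)}) X
    (Function.update X j (C c)) (fun i => ?_) p
  · simpa using this
  · by_cases h : i = j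
    · subst h
      simp
    · simp [Function.update_of_ne h]

/-- If the curve `F = 0` is smooth at `a` and its tangent there is not `X i = a i`, no power of
`X i - a i` vanishes on the curve near `a`. -/
theorem not_mul_pow_eq_mul {F : MvPolynomial (Fin 2) K} (i j : Fin 2) (hij : i ≠ j)
    (hj : eval a (pderiv j F) ≠ 0) (n : ℕ) :
    ∀ s h : MvPolynomial (Fin 2) K, eval a F = 0 → eval a s ≠ 0 →
      s * (X i - C (a i)) ^ n ≠ F * h := by
  set θ := aeval (R := K) (Function.update (X : Fin 2 → MvPolynomial (Fin 2) K) i (C (a i)))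
  have hθ : ∀ p, θ p = 0 → ∃ w, p = (X i - C (a i)) * w := by
    intro p hp
    have := sub_subst_mem i (a i) p
    rw [hp, sub_zero, Ideal.mem_span_singleton] at this
    exact this
  have ht : θ (X i - C (a i)) = 0 := by simp [θ, MvPolynomial.algebraMap_eq]
  have hF : θ F ≠ 0 := by
    intro h
    obtain ⟨w, hw⟩ := hθ F h
    apply hj
    rw [hw, pderiv_mul]
    simp [pderiv_X_of_ne hij]
  have ht0 : (X i - C (a i) : MvPolynomial (Fin 2) K) ≠ 0 := by
    intro h
    have := congrArg (fun p => eval a (pderiv i p)) h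
    simp at this
  induction n with
  | zero =>
    intro s h hFa hs e
    apply hs
    rw [pow_zero, mul_one] at e
    rw [e, map_mul, hFa, zero_mul]
  | succ n ih =>
    intro s h hFa hs e
    have : θ F * θ h = 0 := by
      rw [← map_mul, ← e, map_mul, map_pow, ht]
      simp
    obtain ⟨w, rfl⟩ := hθ h ((mul_eq_zero.mp this).resolve_left hF)
    refine ih s w hFa hs (mul_left_cancel₀ ht0 ?_)
    linear_combination e

/-- The residue field of the affine plane at `a` is `K`. -/
theorem exists_sub_algebraMap_mem_map (x : LocalRingAt a) :
    ∃ c : K, x - algebraMap K _ c ∈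
      Ideal.map (algebraMap _ (LocalRingAt a)) (pointIdeal a) := by
  obtain ⟨h, s, rfl⟩ := IsLocalization.exists_mk'_eq (pointIdeal a).primeCompl x
  have hs : eval a (s : MvPolynomial (Fin 2) K) ≠ 0 := s.2
  refine ⟨eval a h / eval a (s : MvPolynomial (Fin 2) K), ?_⟩
  have hu := IsLocalization.map_units (LocalRingAt a) s
  rw [← Ideal.mul_unit_mem_iff_mem _ hu, sub_mul, IsLocalization.mk'_spec,
    IsScalarTower.algebraMap_apply K (MvPolynomial (Fin 2) K) (LocalRingAt a), ← map_mul, ← map_sub]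
  apply Ideal.mem_map_of_mem
  simp [RingHom.mem_ker, MvPolynomial.algebraMap_eq, div_mul_cancel₀ _ hs]

section Smooth

variable {F : MvPolynomial (Fin 2) K} (hF : eval a F = 0) (hs : ∃ j, eval a (pderiv j F) ≠ 0)

include hF hs

/-- If the derivative of `F` with respect to one coordinate does not vanish at `a`, the other
coordinate is a local parameter of the curve, to first order. -/
theorem exists_le_span_sup_sq : ∃ i j : Fin 2, i ≠ j ∧ eval a (pderiv j F) ≠ 0 ∧
    pointIdeal a ≤ Ideal.span {F, X i - C (a i)} ⊔ pointIdeal a ^ 2 := by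
  obtain ⟨j, hj⟩ := hs
  obtain ⟨i, hij⟩ : ∃ i : Fin 2, i ≠ j := exists_ne j
  refine ⟨i, j, hij, hj, ?_⟩
  have hi : (X i - C (a i) : MvPolynomial (Fin 2) K) ∈
      Ideal.span {F, X i - C (a i)} ⊔ pointIdeal a ^ 2 :=
    Ideal.mem_sup_left (Ideal.subset_span (by simp))
  have hF' : F ∈ Ideal.span {F, X i - C (a i)} ⊔ pointIdeal a ^ 2 :=
    Ideal.mem_sup_left (Ideal.subset_span (by simp))
  have hT := taylor_mem a F
  have huniv : (Finset.univ : Finset (Fin 2)) = {j, i} := by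
    symm
    apply Finset.eq_univ_of_card
    rw [Finset.card_pair hij.symm, Fintype.card_fin]
  rw [← pointIdeal_eq_span, hF, C_0, sub_zero, huniv, Finset.sum_pair hij.symm] at hT
  have hj' : (X j - C (a j) : MvPolynomial (Fin 2) K) ∈
      Ideal.span {F, X i - C (a i)} ⊔ pointIdeal a ^ 2 := by
    have h3 : C (eval a (pderiv j F)) * (X j - C (a j)) ∈
        Ideal.span {F, X i - C (a i)} ⊔ pointIdeal a ^ 2 := by
      have h4 := Ideal.sub_mem _ (Ideal.sub_mem _ hF' (Ideal.mem_sup_right hT))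
        (Ideal.mul_mem_left _ (C (eval a (pderiv i F))) hi)
      convert! h4 using 1
      ring
    have h5 := Ideal.mul_mem_left _ (C (eval a (pderiv j F))⁻¹) h3
    rwa [← mul_assoc, ← C_mul, inv_mul_cancel₀ hj, C_1, one_mul] at h5
  conv_lhs => rw [pointIdeal_eq_span a]
  rw [Ideal.span_le]
  rintro _ ⟨l, rfl⟩
  by_cases hl : l = j
  · rw [hl]; exact hj'
  · have : l = i := by omega
    rw [this]; exact hi

theorem exists_isSmoothGerm :
    ∃ t, IsSmoothGerm K (algebraMap (MvPolynomial (Fin 2) K) (LocalRingAt a) F) t := by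
  obtain ⟨i, j, hij, hj, hle⟩ := exists_le_span_sup_sq hF hs
  refine ⟨algebraMap (MvPolynomial (Fin 2) K) (LocalRingAt a) (X i - C (a i)), ?_, ?_, ?_, ?_, ?_⟩
  · rw [← Localization.AtPrime.map_eq_maximalIdeal]
    exact Ideal.mem_map_of_mem _ hF
  · rw [← Localization.AtPrime.map_eq_maximalIdeal]
    exact Ideal.mem_map_of_mem _ (by simp [RingHom.mem_ker])
  · have h := Ideal.map_mono (f := algebraMap (MvPolynomial (Fin 2) K) (LocalRingAt a)) hle
    rwa [Ideal.map_sup, Ideal.map_pow, Ideal.map_span, Set.image_pair,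
      Localization.AtPrime.map_eq_maximalIdeal] at h
  · intro n hn
    rw [← map_pow, ← Set.image_singleton, ← Ideal.map_span, IsLocalization.mem_map_algebraMap_iff
      (pointIdeal a).primeCompl] at hn
    obtain ⟨⟨⟨q, hq⟩, s⟩, e⟩ := hn
    obtain ⟨h, rfl⟩ := Ideal.mem_span_singleton.mp hq
    rw [← map_mul] at e
    have e' := IsLocalization.injective (LocalRingAt a)
      (pointIdeal a).primeCompl_le_nonZeroDivisors e
    exact not_mul_pow_eq_mul i j hij hj n s h hF s.2 (by rw [mul_comm]; exact e')
  · intro y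
    rw [← Localization.AtPrime.map_eq_maximalIdeal]
    exact exists_sub_algebraMap_mem_map y

theorem le_localMult_iff (n : ℕ) (G : MvPolynomial (Fin 2) K) :
    (n : ℕ∞) ≤ localMult F G a ↔ algebraMap _ (LocalRingAt a) G ∈
      Ideal.map (algebraMap _ (LocalRingAt a)) (Ideal.span {F} ⊔ pointIdeal a ^ n) := by
  obtain ⟨t, ht⟩ := exists_isSmoothGerm hF hs
  rw [localMult, Ideal.map_span, Set.image_pair, ht.le_length_iff, Ideal.map_sup, Ideal.map_span,
    Set.image_singleton, Ideal.map_pow, Localization.AtPrime.map_eq_maximalIdeal]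

theorem localMult_mul (G H : MvPolynomial (Fin 2) K) :
    localMult F (G * H) a = localMult F G a + localMult F H a := by
  obtain ⟨t, ht⟩ := exists_isSmoothGerm hF hs
  rw [localMult_eq, localMult_eq, localMult_eq, map_mul, ht.length_mul]

/-- Vanishing to order `n` at a smooth point of the curve amounts to `n` linear conditions. -/
theorem length_quotient_sup_pow (n : ℕ) :
    Module.length K (LocalRingAt a ⧸
      Ideal.map (algebraMap _ (LocalRingAt a)) (Ideal.span {F} ⊔ pointIdeal a ^ n)) = n := by
  obtain ⟨t, ht⟩ := exists_isSmoothGerm hF hs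
  rw [Ideal.map_sup, Ideal.map_span, Set.image_singleton, Ideal.map_pow,
    Localization.AtPrime.map_eq_maximalIdeal, ht.length_sup_pow]

end Smooth

end AffinePlane

section AffinePlane

variable {K : Type*} [Field K] {a : Fin 2 → K}

/-- Outside of the maximal ideal `m`, elements are invertible modulo `m ^ n`. -/
theorem mem_sup_pow_of_mul_mem {R : Type*} [CommRing R] {m I : Ideal R} [hm : m.IsMaximal] {n : ℕ}
    (hI : m ^ n ≤ I) {s g : R} (hs : s ∉ m) (h : s * g ∈ I) : g ∈ I := by
  have h1 : IsCoprime (Ideal.span {s}) m := by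
    rw [Ideal.isCoprime_iff_sup_eq]
    exact hm.out.2 _ (right_lt_sup.mpr fun hle =>
      hs (hle (Ideal.mem_span_singleton_self s)))
  have h2 := Ideal.isCoprime_iff_exists.mp (h1.pow_right (n := n))
  obtain ⟨u, hu, w, hw, e⟩ := h2
  obtain ⟨u, rfl⟩ := Ideal.mem_span_singleton.mp hu
  have : g = u * (s * g) + g * w := by linear_combination (-g) * e
  rw [this]
  exact Ideal.add_mem _ (Ideal.mul_mem_left _ _ h) (Ideal.mul_mem_left _ _ (hI hw))

instance pointIdeal_isMaximal (a : Fin 2 → K) : (pointIdeal a).IsMaximal :=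
  RingHom.ker_isMaximal_of_surjective _ fun c => ⟨C c, eval_C c⟩

/-- An ideal which contains a power of the ideal of `a` is determined by its localization at `a`. -/
theorem mem_sup_pow_iff_mem_localization (F G : MvPolynomial (Fin 2) K) (n : ℕ) :
    algebraMap _ (LocalRingAt a) G ∈
      Ideal.map (algebraMap _ (LocalRingAt a)) (Ideal.span {F} ⊔ pointIdeal a ^ n) ↔
    G ∈ Ideal.span {F} ⊔ pointIdeal a ^ n := by
  refine ⟨fun h => ?_, Ideal.mem_map_of_mem _⟩
  rw [IsLocalization.mem_map_algebraMap_iff (pointIdeal a).primeCompl] at h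
  obtain ⟨⟨⟨q, hq⟩, s⟩, e⟩ := h
  rw [← map_mul] at e
  have e' := IsLocalization.injective (LocalRingAt a)
    (pointIdeal a).primeCompl_le_nonZeroDivisors e
  refine mem_sup_pow_of_mul_mem (m := pointIdeal a) (n := n) le_sup_right s.2 ?_
  rw [mul_comm]
  simpa [e'] using hq

end AffinePlane

/-! ### A coordinate-free description of intersection multiplicities -/

section Homogeneous

theorem aeval_mul_of_isHomogeneous {σ K T : Type*} [CommRing K] [CommRing T] [Algebra K T]
    {H : MvPolynomial σ K} {d : ℕ} (hH : H.IsHomogeneous d) (r : T) (x : σ → T) :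
    aeval (fun j => r * x j) H = r ^ d * aeval x H := by
  rw [aeval_def, aeval_def, eval₂_eq, eval₂_eq, Finset.mul_sum]
  refine Finset.sum_congr rfl fun m hm => ?_
  have : m.degree = d := by
    by_contra h
    exact (mem_support_iff.mp hm) (hH.coeff_eq_zero h)
  simp_rw [mul_pow, Finset.prod_mul_distrib]
  rw [Finset.prod_pow_eq_pow_sum, ← this, Finsupp.degree_apply]
  ring

variable {K : Type*} [Field K]

theorem eval_smul_of_isHomogeneous {H : MvPolynomial (Fin 3) K} {d : ℕ} (hH : H.IsHomogeneous d)
    (c : K) (v : Fin 3 → K) : eval (c • v) H = c ^ d * eval v H := by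
  have := aeval_mul_of_isHomogeneous hH c v
  rw [aeval_eq_eval, aeval_eq_eval] at this
  exact this

/-- The values of a dehomogenization, at a point with `x_i` invertible, are those of the form at the
normalized coordinates. -/
theorem aeval_dehom {T : Type*} [CommRing T] [Algebra K T] (i : Fin 3) (x : Fin 3 → T) {r : T}
    (hr : r * x i = 1) (H : MvPolynomial (Fin 3) K) :
    aeval (fun j => r * x (i.succAbove j)) (dehom i H) = aeval (fun j => r * x j) H := by
  rw [dehom, ← AlgHom.comp_apply, comp_aeval]
  congr 2
  funext j
  rcases Fin.eq_self_or_eq_succAbove i j with rfl | ⟨j, rfl⟩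
  · simp [hr]
  · simp

/-- The affine coordinates of the point `v` of the projective plane in the chart `x_i = 1`. -/
def affinePt (i : Fin 3) (v : Fin 3 → K) : Fin 2 → K := fun j => v (i.succAbove j) / v i

theorem eval_dehom {i : Fin 3} {v : Fin 3 → K} (hv : v i ≠ 0) {H : MvPolynomial (Fin 3) K} {d : ℕ}
    (hH : H.IsHomogeneous d) :
    eval (affinePt i v) (dehom i H) = (v i)⁻¹ ^ d * eval v H := by
  have h1 := aeval_dehom i v (inv_mul_cancel₀ hv) H
  rw [aeval_mul_of_isHomogeneous hH] at h1
  rw [aeval_eq_eval, aeval_eq_eval] at h1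
  rw [← h1]
  congr 2
  funext j
  rw [affinePt, div_eq_inv_mul]

theorem eval_dehom_eq_zero_iff {i : Fin 3} {v : Fin 3 → K} (hv : v i ≠ 0)
    {H : MvPolynomial (Fin 3) K} {d : ℕ} (hH : H.IsHomogeneous d) :
    eval (affinePt i v) (dehom i H) = 0 ↔ eval v H = 0 := by
  rw [eval_dehom hv hH]
  simp [hv]

theorem pderiv_dehom (i : Fin 3) (j : Fin 2) (H : MvPolynomial (Fin 3) K) :
    pderiv j (dehom i H) = dehom i (pderiv (i.succAbove j) H) := by
  unfold dehom
  induction H using MvPolynomial.induction_on with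
  | C c => simp [MvPolynomial.algebraMap_eq]
  | add p q hp hq => rw [map_add, map_add, map_add, map_add, hp, hq]
  | mul_X p k hp =>
    rw [map_mul, pderiv_mul, hp, pderiv_mul, map_add, map_mul, map_mul, aeval_X]
    congr 2
    rcases Fin.eq_self_or_eq_succAbove i k with rfl | ⟨k, rfl⟩
    · rw [pderiv_X_of_ne (Fin.succAbove_ne k j).symm]
      simp
    · by_cases h : k = j
      · subst h
        simp
      · rw [pderiv_X_of_ne (fun h' => h (Fin.succAbove_right_injective h'))]
        simp [pderiv_X_of_ne h]

/-- By Euler's formula, a smooth point of a projective plane curve is smooth in each chart. -/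
theorem exists_pderiv_dehom_ne_zero {i : Fin 3} {v : Fin 3 → K} (hv : v i ≠ 0)
    {F : MvPolynomial (Fin 3) K} {d : ℕ} (hF : F.IsHomogeneous d) (h0 : eval v F = 0)
    (hs : ∃ j, eval v (pderiv j F) ≠ 0) :
    ∃ j, eval (affinePt i v) (pderiv j (dehom i F)) ≠ 0 := by
  by_contra! h
  simp_rw [pderiv_dehom, eval_dehom_eq_zero_iff hv hF.pderiv] at h
  obtain ⟨k, hk⟩ := hs
  rcases Fin.eq_self_or_eq_succAbove i k with rfl | ⟨k, rfl⟩
  · have := congrArg (eval v) hF.sum_X_mul_pderiv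
    rw [map_sum, map_nsmul, h0, smul_zero, Fin.sum_univ_succAbove _ k] at this
    simp [h, hv, hk] at this
  · exact hk (h k)

/-- The homogeneous ideal of the point `v` of the projective plane. -/
def lineIdeal (v : Fin 3 → K) : Ideal (MvPolynomial (Fin 3) K) :=
  Ideal.span {ℓ | ℓ.IsHomogeneous 1 ∧ eval v ℓ = 0}

/-- The form `G` vanishes to order at least `n` at `v` along the curve `F = 0`: up to a form which
does not vanish at `v`, it lies in the ideal generated by `F` and the `n`-th power of the ideal of
`v`. This is phrased without a choice of an affine chart. -/
def MultGe (F G : MvPolynomial (Fin 3) K) (v : Fin 3 → K) (n : ℕ) : Prop :=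
  ∃ (s : MvPolynomial (Fin 3) K) (N : ℕ), s.IsHomogeneous N ∧ eval v s ≠ 0 ∧
    s * G ∈ Ideal.span {F} ⊔ lineIdeal v ^ n

theorem lineIdeal_le_ker (v : Fin 3 → K) : lineIdeal v ≤ RingHom.ker (eval v) := by
  rw [lineIdeal, Ideal.span_le]
  exact fun ℓ hℓ => hℓ.2

theorem map_dehom_lineIdeal {i : Fin 3} {v : Fin 3 → K} (hv : v i ≠ 0) :
    (lineIdeal v).map (aeval (R := K) (i.insertNth (α := fun _ => MvPolynomial (Fin 2) K) 1 X)) ≤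
      pointIdeal (affinePt i v) := by
  rw [lineIdeal, Ideal.map_span, Ideal.span_le]
  rintro _ ⟨ℓ, ⟨h1, h2⟩, rfl⟩
  exact (eval_dehom_eq_zero_iff hv h1).mpr h2

/-- The homogenization of a polynomial, as a form divided by a power of `x_i`. -/
def homogenizeAway (i : Fin 3) :
    MvPolynomial (Fin 2) K →ₐ[K] Localization.Away (X i : MvPolynomial (Fin 3) K) :=
  aeval fun j => IsLocalization.Away.invSelf (X i : MvPolynomial (Fin 3) K) *
    algebraMap (MvPolynomial (Fin 3) K) _ (X (i.succAbove j))

theorem exists_homogenizeAway_dehom (i : Fin 3) {H : MvPolynomial (Fin 3) K} {d : ℕ}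
    (hH : H.IsHomogeneous d) :
    ∃ u : Localization.Away (X i : MvPolynomial (Fin 3) K), IsUnit u ∧
      homogenizeAway i (dehom i H) = u * algebraMap (MvPolynomial (Fin 3) K) _ H := by
  set T := Localization.Away (X i : MvPolynomial (Fin 3) K)
  set r : T := IsLocalization.Away.invSelf (X i : MvPolynomial (Fin 3) K) with hr'
  set x : Fin 3 → T := fun j => algebraMap (MvPolynomial (Fin 3) K) T (X j)
  have hr : r * x i = 1 := by
    rw [mul_comm]; exact IsLocalization.Away.mul_invSelf _
  have hx : (aeval x : MvPolynomial (Fin 3) K →ₐ[K] T) = IsScalarTower.toAlgHom K _ T :=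
    algHom_ext fun j => by simp [x]
  refine ⟨r ^ d, (IsUnit.of_mul_eq_one _ hr).pow d, ?_⟩
  have h1 := aeval_dehom i x hr H
  rw [aeval_mul_of_isHomogeneous hH, hx] at h1
  exact h1

/-- Homogenizing an ideal membership costs a power of `x_i`. -/
theorem exists_pow_mul_mem_of_dehom_mem {i : Fin 3} {J : Ideal (MvPolynomial (Fin 2) K)}
    {J' : Ideal (MvPolynomial (Fin 3) K)} (hJ : J.map (homogenizeAway i) ≤
      J'.map (algebraMap _ (Localization.Away (X i : MvPolynomial (Fin 3) K))))
    {H : MvPolynomial (Fin 3) K} {d : ℕ} (hH : H.IsHomogeneous d) (h : dehom i H ∈ J) :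
    ∃ N : ℕ, X i ^ N * H ∈ J' := by
  obtain ⟨u, hu, e⟩ := exists_homogenizeAway_dehom i hH
  have h1 := hJ (Ideal.mem_map_of_mem _ h)
  rw [e, Ideal.unit_mul_mem_iff_mem _ hu,
    IsLocalization.mem_map_algebraMap_iff (Submonoid.powers (X i : MvPolynomial (Fin 3) K))] at h1
  obtain ⟨⟨⟨q, hq⟩, ⟨_, N, rfl⟩⟩, e2⟩ := h1
  rw [← map_mul] at e2
  have e3 := IsLocalization.injective (Localization.Away (X i : MvPolynomial (Fin 3) K))
    (powers_le_nonZeroDivisors_of_noZeroDivisors (X_ne_zero i)) e2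
  refine ⟨N, ?_⟩
  rw [mul_comm]
  simpa [e3] using hq

section Comparison

variable {F G : MvPolynomial (Fin 3) K} {d e : ℕ} {v : Fin 3 → K} {n : ℕ} {i : Fin 3}
  (hv : v i ≠ 0)

include hv

theorem MultGe.dehom_mem (h : MultGe F G v n) :
    dehom i G ∈ Ideal.span {dehom i F} ⊔ pointIdeal (affinePt i v) ^ n := by
  obtain ⟨s, N, hsN, hs, h⟩ := h
  have h1 := Ideal.mem_map_of_mem
    (aeval (R := K) (i.insertNth (α := fun _ => MvPolynomial (Fin 2) K) 1 X)) h
  rw [Ideal.map_sup, Ideal.map_pow, Ideal.map_span, Set.image_singleton, map_mul] at h1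
  refine mem_sup_pow_of_mul_mem (m := pointIdeal (affinePt i v)) (n := n) le_sup_right
    (s := dehom i s) (fun hc => hs ((eval_dehom_eq_zero_iff hv hsN).mp hc)) ?_
  exact sup_le_sup le_rfl (Ideal.pow_right_mono (map_dehom_lineIdeal hv) n) h1

theorem multGe_of_dehom_mem (hF : F.IsHomogeneous d) (hG : G.IsHomogeneous e)
    (h : dehom i G ∈ Ideal.span {dehom i F} ⊔ pointIdeal (affinePt i v) ^ n) :
    MultGe F G v n := by
  have hm : (pointIdeal (affinePt i v)).map (homogenizeAway i) ≤
      (lineIdeal v).map (algebraMap _ (Localization.Away (X i : MvPolynomial (Fin 3) K))) := by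
    rw [pointIdeal_eq_span, Ideal.map_span, Ideal.span_le]
    rintro _ ⟨_, ⟨j, rfl⟩, rfl⟩
    have hℓ : (X (i.succAbove j) - C (affinePt i v j) * X i : MvPolynomial (Fin 3) K).IsHomogeneous 1 :=
      (isHomogeneous_X _ _).sub (isHomogeneous_C_mul_X _ _)
    have e2 : dehom i (X (i.succAbove j) - C (affinePt i v j) * X i) = X j - C (affinePt i v j) := by
      simp [dehom, MvPolynomial.algebraMap_eq]
    obtain ⟨u, -, hu⟩ := exists_homogenizeAway_dehom i hℓ
    change homogenizeAway i (X j - C (affinePt i v j)) ∈ _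
    rw [← e2, hu]
    refine Ideal.mul_mem_left _ _ (Ideal.mem_map_of_mem _ (Ideal.subset_span ⟨hℓ, ?_⟩))
    simp [affinePt, div_mul_cancel₀ _ hv]
  have hJ : (Ideal.span {dehom i F} ⊔ pointIdeal (affinePt i v) ^ n).map (homogenizeAway i) ≤
      (Ideal.span {F} ⊔ lineIdeal v ^ n).map
        (algebraMap _ (Localization.Away (X i : MvPolynomial (Fin 3) K))) := by
    obtain ⟨u, hu, e⟩ := exists_homogenizeAway_dehom i hF
    rw [Ideal.map_sup, Ideal.map_sup, Ideal.map_span, Ideal.map_span, Ideal.map_pow, Ideal.map_pow,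
      Set.image_singleton, Set.image_singleton]
    change Ideal.span {homogenizeAway i (dehom i F)} ⊔ _ ≤ _
    rw [e, Ideal.span_singleton_mul_left_unit hu]
    exact sup_le_sup le_rfl (Ideal.pow_right_mono hm n)
  obtain ⟨N, hN⟩ := exists_pow_mul_mem_of_dehom_mem hJ hG h
  exact ⟨X i ^ N, N, by simpa using (isHomogeneous_X K i).pow N, by simp [hv], hN⟩

/-- Intersection multiplicities on a smooth curve, computed in any chart, are described by
`MultGe`. -/
theorem le_localMult_dehom_iff (hF : F.IsHomogeneous d) (hG : G.IsHomogeneous e)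
    (h0 : eval v F = 0) (hs : ∃ j, eval v (pderiv j F) ≠ 0) :
    (n : ℕ∞) ≤ localMult (dehom i F) (dehom i G) (affinePt i v) ↔ MultGe F G v n := by
  rw [le_localMult_iff ((eval_dehom_eq_zero_iff hv hF).mpr h0)
    (exists_pderiv_dehom_ne_zero hv hF h0 hs), mem_sup_pow_iff_mem_localization]
  exact ⟨multGe_of_dehom_mem hv hF hG, MultGe.dehom_mem hv⟩

end Comparison

end Homogeneous

section Invariance

variable {K : Type*} [Field K] {F G : MvPolynomial (Fin 3) K} {v w : Fin 3 → K} {n : ℕ}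

/-- `MultGe` is preserved by ring homomorphisms which respect degrees and send the point to another
one. They need not be `K`-linear, so that Galois conjugation is covered. -/
theorem MultGe.map_of_eval_eq (Φ : MvPolynomial (Fin 3) K →+* MvPolynomial (Fin 3) K)
    (hΦ : ∀ (h : MvPolynomial (Fin 3) K) (d : ℕ), h.IsHomogeneous d → (Φ h).IsHomogeneous d)
    (τ : K →+* K) (he : ∀ h, eval w (Φ h) = τ (eval v h)) (h : MultGe F G v n) :
    MultGe (Φ F) (Φ G) w n := by
  obtain ⟨s, N, hsN, hs, h⟩ := h
  refine ⟨Φ s, N, hΦ _ _ hsN, ?_, ?_⟩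
  · rw [he]
    exact (map_ne_zero τ).mpr hs
  · have h1 := Ideal.mem_map_of_mem Φ h
    rw [Ideal.map_sup, Ideal.map_pow, Ideal.map_span, Set.image_singleton, map_mul] at h1
    suffices hle : (lineIdeal v).map Φ ≤ lineIdeal w from
      sup_le_sup le_rfl (Ideal.pow_right_mono hle n) h1
    rw [lineIdeal, Ideal.map_span, Ideal.span_le]
    rintro _ ⟨ℓ, ⟨h1, h2⟩, rfl⟩
    exact Ideal.subset_span ⟨hΦ _ _ h1, by rw [he, h2, map_zero]⟩

theorem MultGe.map (τ : K →+* K) (h : MultGe F G v n) :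
    MultGe (MvPolynomial.map τ F) (MvPolynomial.map τ G) (τ ∘ v) n :=
  h.map_of_eval_eq (MvPolynomial.map τ) (fun _ _ hh => hh.map τ) τ fun p => (map_eval τ v p).symm

theorem isHomogeneous_linSubst (M : Matrix (Fin 3) (Fin 3) K) {d : ℕ} (hF : F.IsHomogeneous d) :
    (linSubst M F).IsHomogeneous d := by
  have := hF.aeval (R := K) (fun i => ∑ j, C (M i j) * X j) (n := 1) fun i =>
    IsHomogeneous.sum _ _ _ fun j _ => isHomogeneous_C_mul_X _ _
  rwa [one_mul] at this

theorem eval_linSubst (M : Matrix (Fin 3) (Fin 3) K) (F : MvPolynomial (Fin 3) K)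
    (v : Fin 3 → K) : eval v (linSubst M F) = eval (M *ᵥ v) F := by
  rw [linSubst, ← aeval_eq_eval, ← aeval_eq_eval, bind₁, ← AlgHom.comp_apply, comp_aeval]
  congr 2
  funext i
  simp [Matrix.mulVec, dotProduct]

theorem MultGe.linSubst (M : Matrix (Fin 3) (Fin 3) K) (h : MultGe F G (M *ᵥ v) n) :
    MultGe (linSubst M F) (linSubst M G) v n :=
  h.map_of_eval_eq (bind₁ fun i => ∑ j, C (M i j) * X j : _ →ₐ[K] _).toRingHom
    (fun _ _ hh => isHomogeneous_linSubst M hh) (RingHom.id K) fun p => eval_linSubst M p v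

theorem linSubst_linSubst (M N : Matrix (Fin 3) (Fin 3) K) (F : MvPolynomial (Fin 3) K) :
    linSubst M (linSubst N F) = linSubst (N * M) F := by
  rw [linSubst, linSubst, linSubst, bind₁_bind₁]
  congr 2
  funext i
  simp only [map_sum, map_mul, bind₁_X_right, Matrix.mul_apply, Finset.sum_mul, Finset.mul_sum,
    algHom_C, MvPolynomial.algebraMap_eq]
  rw [Finset.sum_comm]
  simp only [mul_assoc]

theorem linSubst_one (F : MvPolynomial (Fin 3) K) : linSubst 1 F = F := by
  rw [linSubst]
  convert! AlgHom.id_apply (R := K) F using 2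
  refine algHom_ext fun i => ?_
  simp [Matrix.one_apply, Finset.sum_ite_eq, apply_ite C, ite_mul]

theorem multGe_linSubst_iff {M : Matrix (Fin 3) (Fin 3) K} (hM : IsUnit M.det) :
    MultGe (linSubst M F) (linSubst M G) v n ↔ MultGe F G (M *ᵥ v) n := by
  refine ⟨fun h => ?_, MultGe.linSubst M⟩
  have h2 : v = M⁻¹ *ᵥ (M *ᵥ v) := by
    rw [Matrix.mulVec_mulVec, Matrix.nonsing_inv_mul _ hM, Matrix.one_mulVec]
  rw [h2] at h
  have := h.linSubst M⁻¹
  rwa [linSubst_linSubst, linSubst_linSubst, Matrix.mul_nonsing_inv _ hM, linSubst_one,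
    linSubst_one] at this

theorem MultGe.smul {c : K} (hc : c ≠ 0) (h : MultGe F G v n) : MultGe F G (c • v) n := by
  obtain ⟨s, N, hsN, hs, h⟩ := h
  refine ⟨s, N, hsN, ?_, ?_⟩
  · rw [eval_smul_of_isHomogeneous hsN]
    exact mul_ne_zero (pow_ne_zero _ hc) hs
  · suffices hle : lineIdeal v ≤ lineIdeal (c • v) from
      sup_le_sup le_rfl (Ideal.pow_right_mono hle n) h
    refine Ideal.span_mono fun ℓ hℓ => ⟨hℓ.1, ?_⟩
    rw [eval_smul_of_isHomogeneous hℓ.1, hℓ.2, mul_zero]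

theorem MultGe.zero_right (F : MvPolynomial (Fin 3) K) (v : Fin 3 → K) (n : ℕ) :
    MultGe F 0 v n := ⟨1, 0, isHomogeneous_one _ _, by simp, by simp⟩

theorem MultGe.add {H : MvPolynomial (Fin 3) K} (hG : MultGe F G v n) (hH : MultGe F H v n) :
    MultGe F (G + H) v n := by
  obtain ⟨s, N, hsN, hs, h⟩ := hG
  obtain ⟨s', N', hsN', hs', h'⟩ := hH
  refine ⟨s * s', N + N', hsN.mul hsN', by simp [hs, hs'], ?_⟩
  have e : s * s' * (G + H) = s' * (s * G) + s * (s' * H) := by ring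
  rw [e]
  exact Ideal.add_mem _ (Ideal.mul_mem_left _ _ h) (Ideal.mul_mem_left _ _ h')

theorem MultGe.mul_left (H : MvPolynomial (Fin 3) K) (hG : MultGe F G v n) :
    MultGe F (H * G) v n := by
  obtain ⟨s, N, hsN, hs, h⟩ := hG
  exact ⟨s, N, hsN, hs, by rw [mul_left_comm]; exact Ideal.mul_mem_left _ _ h⟩

theorem MultGe.of_mul_left {H : MvPolynomial (Fin 3) K} {d : ℕ} (hH : H.IsHomogeneous d)
    (hv : eval v H ≠ 0) (h : MultGe F (H * G) v n) : MultGe F G v n := by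
  obtain ⟨s, N, hsN, hs, h⟩ := h
  exact ⟨s * H, N + d, hsN.mul hH, by simp [hs, hv], by rwa [mul_assoc]⟩

theorem MultGe.eval_eq_zero (h0 : eval v F = 0) (hn : n ≠ 0) (h : MultGe F G v n) :
    eval v G = 0 := by
  obtain ⟨s, N, hsN, hs, h⟩ := h
  have hle : Ideal.span {F} ⊔ lineIdeal v ^ n ≤ RingHom.ker (eval v) :=
    sup_le ((Ideal.span_singleton_le_iff_mem _).mpr h0)
      ((Ideal.pow_le_self hn).trans (lineIdeal_le_ker v))
  have := hle h
  rw [RingHom.mem_ker, map_mul] at this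
  exact (mul_eq_zero.mp this).resolve_left hs

theorem eval_pderiv_eq_zero_of_mem_sq {q : MvPolynomial (Fin 3) K} (hq : q ∈ lineIdeal v ^ 2)
    (i : Fin 3) : eval v (pderiv i q) = 0 := by
  rw [pow_two] at hq
  induction hq using Submodule.mul_induction_on' with
  | mem_mul_mem a ha b hb =>
    have ha' : eval v a = 0 := lineIdeal_le_ker v ha
    have hb' : eval v b = 0 := lineIdeal_le_ker v hb
    rw [pderiv_mul]
    simp [ha', hb']
  | add a _ b _ ha hb => rw [map_add, map_add, ha, hb, add_zero]

/-- To second order at `v`, a curve with contact of order two with `F = 0` is a multiple of `F`. -/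
theorem MultGe.gradient_proportional (h0 : eval v F = 0) (h : MultGe F G v 2) (i j : Fin 3) :
    eval v (pderiv i G) * eval v (pderiv j F) - eval v (pderiv j G) * eval v (pderiv i F) = 0 := by
  have hG := h.eval_eq_zero h0 two_ne_zero
  obtain ⟨s, N, hsN, hs, h⟩ := h
  obtain ⟨b, hb, q, hq, e⟩ := Submodule.mem_sup.mp h
  obtain ⟨b, rfl⟩ := Ideal.mem_span_singleton.mp hb
  have key : ∀ l, eval v s * eval v (pderiv l G) = eval v b * eval v (pderiv l F) := fun l => by
    have := congrArg (fun p => eval v (pderiv l p)) e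
    simp only [map_add, pderiv_mul, eval_pderiv_eq_zero_of_mem_sq hq l, map_mul, h0, hG] at this
    linear_combination -this
  refine (mul_eq_zero.mp (?_ : eval v s * _ = 0)).resolve_left hs
  linear_combination eval v (pderiv j F) * key i - eval v (pderiv i F) * key j

variable {d e : ℕ} (hF : F.IsHomogeneous d) (hG : G.IsHomogeneous e) (hv : v ≠ 0)
  (h0 : eval v F = 0) (hG0 : eval v G = 0)

include hF hG hv hG0

theorem multGe_one : MultGe F G v 1 := by
  obtain ⟨i, hi⟩ := Function.ne_iff.mp hv
  refine multGe_of_dehom_mem hi hF hG (Ideal.mem_sup_right ?_)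
  rw [pow_one]
  exact (eval_dehom_eq_zero_iff hi hG).mpr hG0

include h0

/-- Proportional gradients give contact of order two. In a chart, `F` has a nonzero derivative at the
point, and `G - c F` is singular there, where `c` is the quotient of the derivatives. -/
theorem multGe_two (hs : ∃ j, eval v (pderiv j F) ≠ 0)
    (h : ∀ i j, eval v (pderiv i G) * eval v (pderiv j F) -
      eval v (pderiv j G) * eval v (pderiv i F) = 0) : MultGe F G v 2 := by
  obtain ⟨i, hi⟩ := Function.ne_iff.mp hv
  obtain ⟨j₀, hj₀⟩ := exists_pderiv_dehom_ne_zero hi hF h0 hs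
  set a := affinePt i v
  set c := eval a (pderiv j₀ (dehom i G)) / eval a (pderiv j₀ (dehom i F))
  refine multGe_of_dehom_mem hi hF hG ?_
  have h1 : dehom i G - C c * dehom i F ∈ pointIdeal a ^ 2 := by
    refine mem_pointIdeal_sq ?_ fun j => ?_
    · rw [map_sub, map_mul, (eval_dehom_eq_zero_iff hi hG).mpr hG0,
        (eval_dehom_eq_zero_iff hi hF).mpr h0]
      simp
    · rw [map_sub, pderiv_C_mul, map_sub, map_mul, eval_C, sub_eq_zero]
      have h2 : eval a (pderiv j (dehom i G)) * eval a (pderiv j₀ (dehom i F)) =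
          eval a (pderiv j₀ (dehom i G)) * eval a (pderiv j (dehom i F)) := by
        simp only [a, pderiv_dehom, eval_dehom hi hF.pderiv, eval_dehom hi hG.pderiv]
        linear_combination (v i)⁻¹ ^ (e - 1) * (v i)⁻¹ ^ (d - 1) *
          h (i.succAbove j) (i.succAbove j₀)
      rw [div_mul_eq_mul_div, eq_div_iff hj₀, h2]
  have h3 : dehom i G = C c * dehom i F + (dehom i G - C c * dehom i F) := by ring
  rw [h3]
  exact Ideal.add_mem _ (Ideal.mem_sup_left (Ideal.mul_mem_left _ _
    (Ideal.mem_span_singleton_self _))) (Ideal.mem_sup_right h1)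

end Invariance

/-! ### Homogeneous components and factors -/

section Components

variable {σ K : Type*} [Field K]

theorem homogeneousComponent_mul_of_isHomogeneous {G : MvPolynomial σ K} {n : ℕ}
    (hG : G.IsHomogeneous n) (c : MvPolynomial σ K) (k : ℕ) :
    homogeneousComponent (k + n) (c * G) = homogeneousComponent k c * G := by
  conv_lhs => rw [← sum_homogeneousComponent c]
  rw [Finset.sum_mul, map_sum]
  have : ∀ i, homogeneousComponent (k + n) (homogeneousComponent i c * G) =
      if i = k then homogeneousComponent k c * G else 0 := fun i => by
    rw [homogeneousComponent_of_mem ((homogeneousComponent_isHomogeneous i c).mul hG)]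
    by_cases h : i = k
    · simp [h]
    · rw [if_neg h, if_neg (by omega)]
  simp_rw [this]
  rw [Finset.sum_ite_eq']
  split_ifs with h
  · rfl
  · rw [homogeneousComponent_eq_zero, zero_mul]
    simpa using h

/-- Factors of forms are forms: the lowest and the highest degree occurring in a product are the sums
of those of the factors. -/
theorem isHomogeneous_of_mul {p q : MvPolynomial σ K} {d : ℕ} (h : (p * q).IsHomogeneous d)
    (h0 : p * q ≠ 0) : ∃ e, p.IsHomogeneous e := by
  -- `Ψ p = ∑ i, p_i T ^ i`, where `p_i` are the homogeneous components of `p`.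
  set Ψ : MvPolynomial σ K →ₐ[K] Polynomial (MvPolynomial σ K) :=
    aeval (fun i => Polynomial.X * Polynomial.C (X i))
  have hΨ : ∀ {r : MvPolynomial σ K} {e : ℕ}, r.IsHomogeneous e →
      Ψ r = Polynomial.C r * Polynomial.X ^ e := fun {r e} hr => by
    have h1 := aeval_mul_of_isHomogeneous hr (Polynomial.X : Polynomial (MvPolynomial σ K))
      (fun i => Polynomial.C (X i))
    have h2 : (aeval (fun i => Polynomial.C (X i)) :
        MvPolynomial σ K →ₐ[K] Polynomial (MvPolynomial σ K)) =
        (Polynomial.CAlgHom (R := MvPolynomial σ K) (A := MvPolynomial σ K)).restrictScalars K := by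
      refine algHom_ext fun i => ?_
      simp
    rw [h2] at h1
    rw [mul_comm]
    exact h1
  have hcoeff : ∀ (r : MvPolynomial σ K) (i : ℕ),
      (Ψ r).coeff i = homogeneousComponent i r := fun r i => by
    conv_lhs => rw [← sum_homogeneousComponent r]
    rw [map_sum, Polynomial.finsetSum_coeff]
    simp_rw [hΨ (homogeneousComponent_isHomogeneous _ r), Polynomial.coeff_C_mul_X_pow]
    rw [Finset.sum_ite_eq]
    split_ifs with hi
    · rfl
    · rw [homogeneousComponent_eq_zero]
      simpa using hi
  have hmul : Ψ p * Ψ q = Polynomial.C (p * q) * Polynomial.X ^ d := by rw [← map_mul, hΨ h]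
  have hne : Ψ p * Ψ q ≠ 0 := by
    rw [hmul]
    exact mul_ne_zero (Polynomial.C_ne_zero.mpr h0) (pow_ne_zero _ Polynomial.X_ne_zero)
  have hp := left_ne_zero_of_mul hne
  have hq := right_ne_zero_of_mul hne
  have h1 := Polynomial.natDegree_mul hp hq
  have h2 := Polynomial.natTrailingDegree_mul hp hq
  rw [hmul, Polynomial.natDegree_C_mul_X_pow _ _ h0] at h1
  rw [hmul, Polynomial.natTrailingDegree_mul (Polynomial.C_ne_zero.mpr h0)
    (pow_ne_zero _ Polynomial.X_ne_zero), Polynomial.natTrailingDegree_C,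
    Polynomial.natTrailingDegree_X_pow] at h2
  have h3 := (Ψ p).natTrailingDegree_le_natDegree
  have h4 := (Ψ q).natTrailingDegree_le_natDegree
  refine ⟨(Ψ p).natDegree, ?_⟩
  have hsum := sum_homogeneousComponent p
  generalize hN : (Ψ p).natDegree = N at *
  rw [← hsum]
  refine IsHomogeneous.sum _ _ _ fun i _ => ?_
  rcases lt_trichotomy i N with hi | hi | hi
  · rw [← hcoeff, Polynomial.coeff_eq_zero_of_lt_natTrailingDegree (by omega)]
    exact isHomogeneous_zero _ _ _
  · rw [hi]
    exact homogeneousComponent_isHomogeneous _ _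
  · rw [← hcoeff, Polynomial.coeff_eq_zero_of_natDegree_lt (hN ▸ hi)]
    exact isHomogeneous_zero _ _ _

theorem isHomogeneous_of_dvd {p q : MvPolynomial σ K} {d : ℕ} (hq : q.IsHomogeneous d)
    (h0 : q ≠ 0) (h : p ∣ q) : ∃ e, p.IsHomogeneous e := by
  obtain ⟨r, rfl⟩ := h
  exact isHomogeneous_of_mul hq h0

end Components

/-! ### The Hilbert function of the intersection of two plane curves -/

section Hilbert

variable {K : Type*} [Field K]

/-- The forms of degree `d` in three variables. -/
abbrev Forms (K : Type*) [Field K] (d : ℕ) : Submodule K (MvPolynomial (Fin 3) K) :=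
  homogeneousSubmodule (Fin 3) K d

instance finite_forms (d : ℕ) : Module.Finite K (Forms K d) :=
  Module.Finite.iff_fg.mpr (homogeneousSubmodule_fg (Fin 3) K d)

theorem finrank_forms (d : ℕ) : Module.finrank K (Forms K d) = (d + 2).choose 2 := by
  have h1 : {m : Fin 3 →₀ ℕ | m.degree = d} =
      ((Finset.univ : Finset (Fin 3)).finsuppAntidiag d : Set (Fin 3 →₀ ℕ)) := by
    ext m
    simp [Finsupp.degree_eq_sum]
  rw [Forms, homogeneousSubmodule_eq_finsupp_supported, h1,
    (AddMonoidAlgebra.supportedEquivFinsupp _).finrank_eq]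
  rw [Module.finrank_finsupp_self]
  have := (Finset.univ : Finset (Fin 3)).card_finsuppAntidiag_nat_eq_choose d
  simp only [Finset.card_univ, Fintype.card_fin] at this
  simp only [Finset.coe_sort_coe, Fintype.card_coe, this]
  rw [show 3 + d - 1 = d + 2 by omega]
  exact Nat.choose_symm_add

/-- The forms of degree `m + n + k` in the ideal generated by the forms `F` and `G` of degrees `m`
and `n`. -/
def idealForms (F G : MvPolynomial (Fin 3) K) (m n k : ℕ) : Submodule K (MvPolynomial (Fin 3) K) :=
  (Forms K (n + k)).map (LinearMap.mulLeft K F) ⊔ (Forms K (m + k)).map (LinearMap.mulLeft K G)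

variable {F G : MvPolynomial (Fin 3) K} {m n : ℕ}

theorem idealForms_le (hF : F.IsHomogeneous m) (hG : G.IsHomogeneous n) (k : ℕ) :
    idealForms F G m n k ≤ Forms K (m + n + k) := by
  refine sup_le ?_ ?_
  · rintro _ ⟨a, ha, rfl⟩
    have := hF.mul (show a.IsHomogeneous (n + k) from ha)
    rwa [← add_assoc] at this
  · rintro _ ⟨a, ha, rfl⟩
    have := hG.mul (show a.IsHomogeneous (m + k) from ha)
    rwa [← add_assoc, add_comm n m] at this

theorem idealForms_le_span (k : ℕ) :
    idealForms F G m n k ≤ (Ideal.span {F, G}).restrictScalars K := by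
  refine sup_le ?_ ?_
  · rintro _ ⟨a, ha, rfl⟩
    exact Ideal.mul_mem_right _ _ (Ideal.subset_span (by simp))
  · rintro _ ⟨a, ha, rfl⟩
    exact Ideal.mul_mem_right _ _ (Ideal.subset_span (by simp))

theorem mem_idealForms (hF : F.IsHomogeneous m) (hG : G.IsHomogeneous n) {k : ℕ}
    {H : MvPolynomial (Fin 3) K} (hH : H.IsHomogeneous (m + n + k))
    (h : H ∈ Ideal.span {F, G}) : H ∈ idealForms F G m n k := by
  obtain ⟨a, b, rfl⟩ := Ideal.mem_span_pair.mp h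
  have h1 := homogeneousComponent_mul_of_isHomogeneous hF a (n + k)
  have h2 := homogeneousComponent_mul_of_isHomogeneous hG b (m + k)
  have h3 := homogeneousComponent_eq_self hH
  rw [map_add, show m + n + k = n + k + m by omega, h1, show n + k + m = m + k + n by omega, h2]
    at h3
  rw [← h3]
  refine Submodule.add_mem_sup ?_ ?_
  · exact ⟨_, homogeneousComponent_isHomogeneous _ _, mul_comm _ _⟩
  · exact ⟨_, homogeneousComponent_isHomogeneous _ _, mul_comm _ _⟩

theorem finrank_map_mulLeft (hF : F ≠ 0) (d : ℕ) :
    Module.finrank K ((Forms K d).map (LinearMap.mulLeft K F)) = (d + 2).choose 2 := by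
  have hi : Function.Injective (LinearMap.mulLeft K F) := fun _ _ h => mul_left_cancel₀ hF h
  rw [← (Submodule.equivMapOfInjective _ hi _).finrank_eq, finrank_forms]

theorem choose_two_identity (m n k : ℕ) :
    (m + n + k + 2).choose 2 + (k + 2).choose 2 =
      (n + k + 2).choose 2 + (m + k + 2).choose 2 + m * n := by
  have key : ∀ x : ℕ, 2 * (x + 2).choose 2 = (x + 2) * (x + 1) := fun x => by
    rw [Nat.choose_two_right, Nat.mul_div_cancel' (Nat.even_mul_pred_self _).two_dvd]
    rfl
  have h1 := key (m + n + k)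
  have h2 := key k
  have h3 := key (n + k)
  have h4 := key (m + k)
  nlinarith

/-- The forms that are multiples of both `F` and `G` include the multiples of `F G`. -/
theorem finrank_idealForms_add_le (hF : F.IsHomogeneous m) (hG : G.IsHomogeneous n) (hF0 : F ≠ 0)
    (hG0 : G ≠ 0) (k : ℕ) :
    Module.finrank K (idealForms F G m n k) + m * n ≤ (m + n + k + 2).choose 2 := by
  have h1 := Submodule.finrank_sup_add_finrank_inf_eq
    ((Forms K (n + k)).map (LinearMap.mulLeft K F)) ((Forms K (m + k)).map (LinearMap.mulLeft K G))
  rw [finrank_map_mulLeft hF0, finrank_map_mulLeft hG0] at h1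
  have h2 : (Forms K k).map (LinearMap.mulLeft K (F * G)) ≤
      (Forms K (n + k)).map (LinearMap.mulLeft K F) ⊓
        (Forms K (m + k)).map (LinearMap.mulLeft K G) := by
    rintro _ ⟨c, hc, rfl⟩
    exact ⟨⟨G * c, hG.mul hc, (mul_assoc _ _ _).symm⟩,
      ⟨F * c, hF.mul hc, by simp only [LinearMap.mulLeft_apply]; ring⟩⟩
  have h3 := Submodule.finrank_mono h2
  rw [finrank_map_mulLeft (mul_ne_zero hF0 hG0)] at h3
  have h4 := choose_two_identity m n k
  rw [idealForms]
  omega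

/-- If `F` and `G` are coprime, the forms that are multiples of both are the multiples of `F G`. -/
theorem finrank_idealForms_add (hF : F.IsHomogeneous m) (hG : G.IsHomogeneous n) (hF0 : F ≠ 0)
    (hG0 : G ≠ 0) (hc : IsRelPrime F G) (k : ℕ) :
    Module.finrank K (idealForms F G m n k) + m * n = (m + n + k + 2).choose 2 := by
  have h1 := Submodule.finrank_sup_add_finrank_inf_eq
    ((Forms K (n + k)).map (LinearMap.mulLeft K F)) ((Forms K (m + k)).map (LinearMap.mulLeft K G))
  rw [finrank_map_mulLeft hF0, finrank_map_mulLeft hG0] at h1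
  have h2 : (Forms K (n + k)).map (LinearMap.mulLeft K F) ⊓
        (Forms K (m + k)).map (LinearMap.mulLeft K G) ≤
      (Forms K k).map (LinearMap.mulLeft K (F * G)) := by
    rintro _ ⟨⟨a, ha, rfl⟩, ⟨b, hb, e⟩⟩
    simp only [LinearMap.mulLeft_apply] at e
    obtain ⟨c, rfl⟩ : G ∣ a := hc.symm.dvd_of_dvd_mul_left ⟨b, e.symm⟩
    refine ⟨homogeneousComponent k c, homogeneousComponent_isHomogeneous _ _, ?_⟩
    have h3 := homogeneousComponent_mul_of_isHomogeneous hG c k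
    rw [mul_comm c G, add_comm k n, homogeneousComponent_eq_self ha] at h3
    simp only [LinearMap.mulLeft_apply]
    rw [h3]
    ring
  have h3 := Submodule.finrank_mono h2
  rw [finrank_map_mulLeft (mul_ne_zero hF0 hG0)] at h3
  have h4 := choose_two_identity m n k
  have h5 := finrank_idealForms_add_le hF hG hF0 hG0 k
  rw [idealForms] at h5 ⊢
  omega

/-- Two projective plane curves over an algebraically closed field intersect: otherwise `F` and `G`
generate all forms of large degree, by the Nullstellensatz, and there are too many of these. -/
theorem exists_common_zero [IsAlgClosed K] (hF : F.IsHomogeneous m) (hG : G.IsHomogeneous n)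
    (hF0 : F ≠ 0) (hG0 : G ≠ 0) (hm : m ≠ 0) (hn : n ≠ 0) :
    ∃ v : Fin 3 → K, v ≠ 0 ∧ eval v F = 0 ∧ eval v G = 0 := by
  by_contra! h
  have h1 : idealOfVars (Fin 3) K ≤ (Ideal.span {F, G}).radical := by
    rw [← vanishingIdeal_zeroLocus_eq_radical (K := K), idealOfVars, Ideal.span_le]
    rintro _ ⟨i, rfl⟩
    rw [SetLike.mem_coe, mem_vanishingIdeal_iff]
    intro v hv
    by_cases hv0 : v = 0
    · simp [hv0]
    · have hv' := (mem_zeroLocus_iff).mp hv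
      refine absurd ?_ (h v hv0 ?_)
      · simpa [aeval_eq_eval] using hv' G (Ideal.subset_span (by simp))
      · simpa [aeval_eq_eval] using hv' F (Ideal.subset_span (by simp))
  obtain ⟨k, hk⟩ := Ideal.exists_pow_le_of_le_radical_of_fg h1 (idealOfVars_fg (Fin 3) K)
  have h2 : Forms K (m + n + k) ≤ idealForms F G m n k := by
    intro H hH
    refine mem_idealForms hF hG hH (hk (Ideal.pow_le_pow_right (show k ≤ m + n + k by omega) ?_))
    rw [mem_pow_idealOfVars_iff']
    intro x hx
    by_contra hc
    exact hc (IsHomogeneous.coeff_eq_zero hH hx.ne)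
  have : FiniteDimensional K (idealForms F G m n k) :=
    Submodule.finiteDimensional_of_le (idealForms_le hF hG k)
  have h4 := finrank_idealForms_add_le hF hG hF0 hG0 k
  have h3 := Submodule.finrank_mono h2
  rw [finrank_forms] at h3
  have := Nat.mul_pos (Nat.pos_of_ne_zero hm) (Nat.pos_of_ne_zero hn)
  omega

end Hilbert

/-! ### Finiteness of the intersection of two plane curves without common components -/

section Smooth

variable {K : Type*} [Field K] [IsAlgClosed K] {F G : MvPolynomial (Fin 3) K} {m n : ℕ}

/-- A smooth plane curve has no common component with a curve of smaller degree: the curve and a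
residual component would meet, in a singular point. -/
theorem isRelPrime_of_smooth (hF : F.IsHomogeneous m)
    (hs : ∀ v : Fin 3 → K, v ≠ 0 → eval v F = 0 → ∃ i, eval v (pderiv i F) ≠ 0)
    (hF0 : F ≠ 0) (hG : G.IsHomogeneous n) (hG0 : G ≠ 0) (hnm : n < m) : IsRelPrime F G := by
  intro p hpF hpG
  obtain ⟨e, he⟩ := isHomogeneous_of_dvd hF hF0 hpF
  have hp0 : p ≠ 0 := ne_zero_of_dvd_ne_zero hF0 hpF
  have hen : e ≤ n := by
    obtain ⟨q, rfl⟩ := hpG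
    have := hG.totalDegree hG0
    rw [totalDegree_mul_of_isDomain hp0 (right_ne_zero_of_mul hG0), he.totalDegree hp0] at this
    omega
  obtain ⟨q, rfl⟩ := hpF
  have hq0 := right_ne_zero_of_mul hF0
  obtain ⟨e', he'⟩ := isHomogeneous_of_dvd hF hF0 (dvd_mul_left q p)
  have hm : m = e + e' := hF.inj_right (he.mul he') hF0
  by_cases h0 : e = 0
  · subst h0
    have := totalDegree_eq_zero_iff_eq_C.mp (he.totalDegree hp0)
    rw [this]
    refine (isUnit_iff_ne_zero.mpr fun h => hp0 ?_).map C
    rw [this, h, C_0]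
  · obtain ⟨v, hv, h1, h2⟩ := exists_common_zero he he' hp0 hq0 h0 (by omega)
    obtain ⟨i, hi⟩ := hs v hv (by rw [map_mul, h1, zero_mul])
    rw [pderiv_mul] at hi
    simp [h1, h2] at hi

end Smooth

section Affine

variable {K : Type*} [Field K] {F G : MvPolynomial (Fin 3) K} {m n : ℕ} (i : Fin 3)

/-- The coordinate ring of the intersection of two plane curves in the chart `x_i = 1`. -/
abbrev AffineInter (i : Fin 3) (F G : MvPolynomial (Fin 3) K) : Type _ :=
  MvPolynomial (Fin 2) K ⧸ Ideal.span {dehom i F, dehom i G}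

/-- The restriction of a form to the intersection of two plane curves in the chart `x_i = 1`. -/
def restrictForm (i : Fin 3) (F G : MvPolynomial (Fin 3) K) :
    MvPolynomial (Fin 3) K →ₐ[K] AffineInter i F G :=
  (Ideal.Quotient.mkₐ K _).comp
    (aeval (R := K) (i.insertNth (α := fun _ => MvPolynomial (Fin 2) K) 1 X))

theorem restrictForm_eq_zero_iff {H : MvPolynomial (Fin 3) K} :
    restrictForm i F G H = 0 ↔ dehom i H ∈ Ideal.span {dehom i F, dehom i G} :=
  Ideal.Quotient.eq_zero_iff_mem

/-- Polynomials of degree at most `d` are dehomogenizations of forms of degree `d`. -/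
theorem exists_isHomogeneous_dehom_eq (p : MvPolynomial (Fin 2) K) {d : ℕ}
    (hd : p.totalDegree ≤ d) : ∃ H : MvPolynomial (Fin 3) K, H.IsHomogeneous d ∧ dehom i H = p := by
  refine ⟨∑ m ∈ p.support, rename i.succAbove (monomial m (coeff m p)) * X i ^ (d - m.degree),
    IsHomogeneous.sum _ _ _ fun m hm => ?_, ?_⟩
  · have hmd : m.degree ≤ d := by
      refine le_trans ?_ hd
      rw [Finsupp.degree_apply]
      exact le_totalDegree hm
    have h1 := ((isHomogeneous_monomial (d := m) (coeff m p) rfl).rename_isHomogeneous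
      (f := i.succAbove)).mul (isHomogeneous_X_pow (R := K) i (d - m.degree))
    rwa [Nat.add_sub_cancel' hmd] at h1
  · have h1 : ∀ r : MvPolynomial (Fin 2) K, dehom i (rename i.succAbove r) = r := fun r => by
      rw [dehom, aeval_rename]
      convert! aeval_X_left_apply r using 2
      congr 1
      funext j
      simp
    have h2 : dehom i (X i : MvPolynomial (Fin 3) K) = 1 := by simp [dehom]
    rw [dehom, map_sum]
    conv_rhs => rw [p.as_sum]
    refine Finset.sum_congr rfl fun m _ => ?_
    rw [map_mul, map_pow, ← dehom, ← dehom, h1, h2, one_pow, mul_one]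

theorem eq_zero_of_dehom_eq_zero {H : MvPolynomial (Fin 3) K} {d : ℕ} (hH : H.IsHomogeneous d)
    (h : dehom i H = 0) : H = 0 := by
  obtain ⟨u, hu, e⟩ := exists_homogenizeAway_dehom i hH
  rw [h, map_zero] at e
  have h1 := (hu.mul_right_eq_zero).mp e.symm
  rw [← map_zero (algebraMap (MvPolynomial (Fin 3) K) _)] at h1
  exact IsLocalization.injective (Localization.Away (X i : MvPolynomial (Fin 3) K))
    (powers_le_nonZeroDivisors_of_noZeroDivisors (X_ne_zero i)) h1

/-- The restrictions of the forms of a given degree to the intersection. -/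
def restrictedForms (i : Fin 3) (F G : MvPolynomial (Fin 3) K) (d : ℕ) :
    Submodule K (AffineInter i F G) :=
  (Forms K d).map (restrictForm i F G).toLinearMap

theorem finrank_restrictedForms_add (k : ℕ) :
    Module.finrank K (restrictedForms i F G (m + n + k)) +
      Module.finrank K (LinearMap.ker ((restrictForm i F G).toLinearMap.domRestrict
        (Forms K (m + n + k)))) = (m + n + k + 2).choose 2 := by
  rw [← finrank_forms (K := K), ← LinearMap.finrank_range_add_finrank_ker
    ((restrictForm i F G).toLinearMap.domRestrict (Forms K (m + n + k))),
    LinearMap.range_domRestrict]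
  rfl

theorem restrictForm_eq_zero_of_mem_span {H : MvPolynomial (Fin 3) K}
    (h : H ∈ Ideal.span {F, G}) : restrictForm i F G H = 0 := by
  rw [restrictForm_eq_zero_iff]
  have := Ideal.mem_map_of_mem
    (aeval (R := K) (i.insertNth (α := fun _ => MvPolynomial (Fin 2) K) 1 X)) h
  rwa [Ideal.map_span, Set.image_pair] at this

section

variable (hF : F.IsHomogeneous m) (hG : G.IsHomogeneous n) (hF0 : F ≠ 0)
  (hG0 : G ≠ 0) (hc : IsRelPrime F G)
include hF hG hF0 hG0 hc

theorem finrank_restrictedForms_le (k : ℕ) :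
    Module.finrank K (restrictedForms i F G (m + n + k)) ≤ m * n := by
  have h1 := finrank_restrictedForms_add i (F := F) (G := G) (m := m) (n := n) k
  have h2 := finrank_idealForms_add hF hG hF0 hG0 hc k
  have h3 : (idealForms F G m n k).submoduleOf (Forms K (m + n + k)) ≤
      LinearMap.ker ((restrictForm i F G).toLinearMap.domRestrict (Forms K (m + n + k))) :=
    fun H hH => restrictForm_eq_zero_of_mem_span i (idealForms_le_span k hH)
  have h4 := Submodule.finrank_mono h3
  rw [(Submodule.submoduleOfEquivOfLe (idealForms_le hF hG k)).finrank_eq] at h4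
  omega

/-- Finitely many functions on the affine part of the intersection are restrictions of forms of one
large degree, and these span a space of dimension at most `m n`. -/
theorem rank_affineInter_le : Module.rank K (AffineInter i F G) ≤ (m * n : ℕ) := by
  refine rank_le fun s hs => ?_
  have h1 : ∀ b : AffineInter i F G, ∃ d₀, ∀ d ≥ d₀, b ∈ restrictedForms i F G d := fun b => by
    obtain ⟨p, rfl⟩ := Ideal.Quotient.mk_surjective b
    refine ⟨p.totalDegree, fun d hd => ?_⟩
    obtain ⟨H, hH, rfl⟩ := exists_isHomogeneous_dehom_eq i p hd
    exact ⟨H, hH, rfl⟩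
  choose d₀ hd₀ using h1
  have h2 : Submodule.span K (s : Set (AffineInter i F G)) ≤
      restrictedForms i F G (m + n + s.sup d₀) := by
    rw [Submodule.span_le]
    intro b hb
    exact hd₀ b _ ((Finset.le_sup (f := d₀) hb).trans (Nat.le_add_left _ _))
  have : Module.Finite K (restrictedForms i F G (m + n + s.sup d₀)) := by
    unfold restrictedForms
    infer_instance
  have h3 := Submodule.finrank_mono h2
  rw [finrank_span_finset_eq_card hs] at h3
  exact h3.trans (finrank_restrictedForms_le i hF hG hF0 hG0 hc _)

theorem finite_affineInter : Module.Finite K (AffineInter i F G) :=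
  Module.rank_lt_aleph0_iff.mp
    ((rank_affineInter_le i hF hG hF0 hG0 hc).trans_lt (Cardinal.natCast_lt_aleph0))

/-- If `x_i` is not a zero divisor modulo `F` and `G`, that is, if the line `x_i = 0` does not meet the
intersection, then a form that restricts to zero lies in the ideal, and no dimension is lost. -/
theorem finrank_affineInter
    (hX : ∀ H : MvPolynomial (Fin 3) K, X i * H ∈ Ideal.span {F, G} → H ∈ Ideal.span {F, G}) :
    Module.finrank K (AffineInter i F G) = m * n := by
  have hfin := finite_affineInter i hF hG hF0 hG0 hc
  refine le_antisymm (Module.finrank_le_of_rank_le (rank_affineInter_le i hF hG hF0 hG0 hc)) ?_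
  have h1 := finrank_restrictedForms_add i (F := F) (G := G) (m := m) (n := n) 0
  have h2 := finrank_idealForms_add hF hG hF0 hG0 hc 0
  have h3 : LinearMap.ker ((restrictForm i F G).toLinearMap.domRestrict (Forms K (m + n + 0))) ≤
      (idealForms F G m n 0).submoduleOf (Forms K (m + n + 0)) := by
    intro H hH
    have hH' := (restrictForm_eq_zero_iff i).mp hH
    have hJ : (Ideal.span {dehom i F, dehom i G}).map (homogenizeAway i) ≤
        (Ideal.span {F, G}).map
          (algebraMap _ (Localization.Away (X i : MvPolynomial (Fin 3) K))) := by
      rw [Ideal.map_span, Set.image_pair, Ideal.span_le]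
      obtain ⟨u, -, hu⟩ := exists_homogenizeAway_dehom i hF
      obtain ⟨w, -, hw⟩ := exists_homogenizeAway_dehom i hG
      rintro _ (rfl | rfl)
      · rw [hu]
        exact Ideal.mul_mem_left _ _ (Ideal.mem_map_of_mem _ (Ideal.subset_span (by simp)))
      · rw [hw]
        exact Ideal.mul_mem_left _ _ (Ideal.mem_map_of_mem _ (Ideal.subset_span (by simp)))
    obtain ⟨N, hN⟩ := exists_pow_mul_mem_of_dehom_mem hJ H.2 hH'
    have hX' : ∀ N : ℕ, X i ^ N * (H : MvPolynomial (Fin 3) K) ∈ Ideal.span {F, G} →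
        (H : MvPolynomial (Fin 3) K) ∈ Ideal.span {F, G} := fun N => by
      induction N with
      | zero => simp
      | succ N ih =>
        intro hN
        rw [pow_succ', mul_assoc] at hN
        exact ih (hX _ hN)
    exact mem_idealForms hF hG H.2 (hX' N hN)
  have h4 := Submodule.finrank_mono h3
  rw [(Submodule.submoduleOfEquivOfLe (idealForms_le hF hG 0)).finrank_eq] at h4
  have h5 := Submodule.finrank_le (restrictedForms i F G (m + n + 0))
  omega

end

/-- Two plane curves which do not meet on the line `x_i = 0` have coprime equations there, so that
`x_i` is not a zero divisor modulo their ideal. -/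
theorem mem_span_pair_of_X_mul_mem [IsAlgClosed K]
    (h : ∀ v : Fin 3 → K, v ≠ 0 → v i = 0 → eval v F = 0 → eval v G ≠ 0)
    (hF0 : eval 0 F = 0)
    {H : MvPolynomial (Fin 3) K} (hH : X i * H ∈ Ideal.span {F, G}) : H ∈ Ideal.span {F, G} := by
  -- `θ` restricts to the line `x_i = 0`, and `ι` is a section of it.
  set θ : MvPolynomial (Fin 3) K →ₐ[K] MvPolynomial (Fin 2) K :=
    aeval (i.insertNth (α := fun _ => MvPolynomial (Fin 2) K) 0 X)
  set ι : MvPolynomial (Fin 2) K →ₐ[K] MvPolynomial (Fin 3) K := aeval fun j => X (i.succAbove j)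
  have hθι : ∀ p, θ (ι p) = p := fun p => by
    rw [← AlgHom.comp_apply]
    convert! AlgHom.id_apply (R := K) p using 2
    exact algHom_ext fun j => by simp [θ, ι]
  have hθX : θ (X i) = 0 := by simp [θ]
  have hι : ∀ p, X i ∣ p - ι (θ p) := fun p => by
    rw [← Ideal.mem_span_singleton]
    have := aeval_sub_aeval_mem (Ideal.span {(X i : MvPolynomial (Fin 3) K)}) X
      (fun k => ι (θ (X k))) (fun k => ?_) p
    · have e : (aeval (fun k => ι (θ (X k))) : MvPolynomial (Fin 3) K →ₐ[K] _) = ι.comp θ :=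
        algHom_ext fun j => by simp
      rw [e] at this
      simpa using this
    · rcases Fin.eq_self_or_eq_succAbove i k with rfl | ⟨k, rfl⟩
      · rw [hθX, map_zero, sub_zero]
        exact Ideal.mem_span_singleton_self _
      · simp [θ, ι]
  have hdvd : ∀ p, θ p = 0 → X i ∣ p := fun p hp => by simpa [hp] using hι p
  have heval : ∀ (a : Fin 2 → K) p, eval a (θ p) = eval (i.insertNth (α := fun _ => K) 0 a) p :=
    fun a p => by
      rw [← aeval_eq_eval, ← aeval_eq_eval, ← AlgHom.comp_apply, comp_aeval]
      congr 2
      funext k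
      rcases Fin.eq_self_or_eq_succAbove i k with rfl | ⟨k, rfl⟩ <;> simp
  have hrel : IsRelPrime (θ F) (θ G) := by
    intro p hpF hpG
    have hz : ∀ j, ∃ N : ℕ, p ∣ X j ^ N := fun j => by
      have : (X j : MvPolynomial (Fin 2) K) ∈ (Ideal.span {p}).radical := by
        rw [← vanishingIdeal_zeroLocus_eq_radical (K := K), mem_vanishingIdeal_iff]
        intro a ha
        have hpa : eval a p = 0 := by
          simpa [aeval_eq_eval] using
            (mem_zeroLocus_iff).mp ha p (Ideal.mem_span_singleton_self _)
        by_cases ha0 : a = 0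
        · simp [ha0]
        · have hv : (i.insertNth (α := fun _ => K) 0 a) ≠ 0 := fun h' => ha0 <| by
            funext k
            have := congrFun h' (i.succAbove k)
            simpa using this
          refine absurd ?_ (h _ hv (by simp) ?_)
          · obtain ⟨q, hq⟩ := hpG
            rw [← heval, hq, map_mul, hpa, zero_mul]
          · obtain ⟨q, hq⟩ := hpF
            rw [← heval, hq, map_mul, hpa, zero_mul]
      obtain ⟨N, hN⟩ := this
      exact ⟨N, Ideal.mem_span_singleton.mp hN⟩
    obtain ⟨N, hN⟩ := hz 0
    obtain ⟨N', hN'⟩ := hz 1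
    have h01 : IsRelPrime (X 0 : MvPolynomial (Fin 2) K) (X 1) :=
      (Irreducible.isRelPrime_iff_not_dvd X_prime.irreducible).mpr fun h' => by
        simp at h'
    exact h01.pow hN hN'
  obtain ⟨a, b, e⟩ := Ideal.mem_span_pair.mp hH
  have e1 : θ a * θ F = - (θ b * θ G) := by
    have := congrArg θ e
    rw [map_add, map_mul, map_mul, map_mul, hθX, zero_mul] at this
    linear_combination this
  by_cases hθG : θ G = 0
  · rw [hθG, isRelPrime_zero_right] at hrel
    have h1 := heval 0 F
    rw [show (i.insertNth (α := fun _ => K) 0 0 : Fin 3 → K) = 0 by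
      funext k
      rcases Fin.eq_self_or_eq_succAbove i k with rfl | ⟨k, rfl⟩ <;> simp, hF0] at h1
    exact absurd h1 (hrel.map (eval 0)).ne_zero
  · obtain ⟨c, hc⟩ : θ G ∣ θ a :=
      hrel.symm.dvd_of_dvd_mul_right (e1 ▸ (dvd_neg.mpr (dvd_mul_left _ _)))
    obtain ⟨a', ha'⟩ := hdvd (a - ι c * G) (by rw [map_sub, map_mul, hθι, hc]; ring)
    obtain ⟨b', hb'⟩ := hdvd (b + ι c * F) (by
      rw [map_add, map_mul, hθι]
      refine mul_left_cancel₀ hθG ?_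
      rw [hc] at e1
      linear_combination e1)
    refine Ideal.mem_span_pair.mpr ⟨a', b', mul_left_cancel₀ (X_ne_zero i) ?_⟩
    rw [← e]
    linear_combination (-F) * ha' - G * hb'

end Affine

/-! ### Finite subschemes of the affine plane -/

section FiniteScheme

variable {K : Type*} [Field K] {I : Ideal (MvPolynomial (Fin 2) K)}

theorem pointIdeal_injective : Function.Injective (pointIdeal : (Fin 2 → K) → _) := by
  intro a b h
  funext j
  have h1 : (X j - C (a j) : MvPolynomial (Fin 2) K) ∈ pointIdeal a := by simp [RingHom.mem_ker]
  rw [h] at h1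
  have h2 : eval b (X j - C (a j)) = 0 := h1
  simp only [map_sub, eval_X, eval_C] at h2
  exact (sub_eq_zero.mp h2).symm

theorem finite_zeroLocus [Module.Finite K (MvPolynomial (Fin 2) K ⧸ I)] :
    (zeroLocus K I).Finite := by
  have : IsArtinianRing (MvPolynomial (Fin 2) K ⧸ I) := IsArtinianRing.of_finite K _
  have hle : ∀ a : zeroLocus K I, ∀ p ∈ I, eval (a : Fin 2 → K) p = 0 := fun a p hp => by
    simpa [aeval_eq_eval] using (mem_zeroLocus_iff).mp a.2 p hp
  let g : zeroLocus K I → PrimeSpectrum (MvPolynomial (Fin 2) K ⧸ I) := fun a =>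
    ⟨RingHom.ker (Ideal.Quotient.lift I (eval (a : Fin 2 → K)) (hle a)), RingHom.ker_isPrime _⟩
  have hg : Function.Injective g := by
    intro a b hab
    apply Subtype.ext
    apply pointIdeal_injective
    have h1 := congrArg (fun J => Ideal.comap (Ideal.Quotient.mk I) J.asIdeal) hab
    simp only [g, RingHom.comap_ker] at h1
    exact h1
  have := Finite.of_injective g hg
  exact Set.toFinite _

variable [IsAlgClosed K]

/-- By the Nullstellensatz, an ideal with finitely many zeros contains a product of powers of the
ideals of these zeros. -/
theorem exists_prod_pow_le (Z : Finset (Fin 2 → K)) (hZ : ∀ a, a ∈ Z ↔ a ∈ zeroLocus K I) :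
    ∃ N : ℕ, ∏ a ∈ Z, pointIdeal a ^ N ≤ I := by
  have h1 : ∏ a ∈ Z, pointIdeal a ≤ I.radical := by
    rw [← vanishingIdeal_zeroLocus_eq_radical (K := K)]
    intro p hp
    rw [mem_vanishingIdeal_iff]
    intro a ha
    have := Ideal.prod_le_inf hp
    rw [Submodule.mem_finsetInf] at this
    rw [aeval_eq_eval]
    exact this a ((hZ a).mpr ha)
  obtain ⟨N, hN⟩ := Ideal.exists_pow_le_of_le_radical_of_fg h1 (IsNoetherian.noetherian _)
  exact ⟨N, by rwa [Finset.prod_pow]⟩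

omit [IsAlgClosed K] in
theorem map_pointIdeal_eq_top {a b : Fin 2 → K} (hab : a ≠ b) :
    (pointIdeal b).map (algebraMap _ (LocalRingAt a)) = ⊤ := by
  have : ¬ pointIdeal b ≤ pointIdeal a := fun h => hab
    (pointIdeal_injective ((pointIdeal_isMaximal b).eq_of_le (pointIdeal_isPrime a).ne_top h)).symm
  obtain ⟨s, hs, hs'⟩ := SetLike.not_le_iff_exists.mp this
  exact Ideal.eq_top_of_isUnit_mem _ (Ideal.mem_map_of_mem _ hs)
    (IsLocalization.map_units (LocalRingAt a) (⟨s, hs'⟩ : (pointIdeal a).primeCompl))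

omit [IsAlgClosed K] in
/-- Locally at `a`, the ideals of the other zeros become trivial. -/
theorem map_pointIdeal_pow_le {Z : Finset (Fin 2 → K)} {N : ℕ} (hN : ∏ a ∈ Z, pointIdeal a ^ N ≤ I)
    {a : Fin 2 → K} (ha : a ∈ Z) :
    (pointIdeal a ^ N).map (algebraMap _ (LocalRingAt a)) ≤
      I.map (algebraMap _ (LocalRingAt a)) := by
  classical
  have h1 := Ideal.map_mono (f := algebraMap _ (LocalRingAt a)) hN
  rw [← Ideal.mapHom_apply, map_prod, ← Finset.mul_prod_erase _ _ ha] at h1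
  rw [Finset.prod_eq_one, mul_one] at h1
  · exact h1
  · intro b hb
    rw [map_pow, Ideal.mapHom_apply, map_pointIdeal_eq_top (Finset.ne_of_mem_erase hb).symm,
      ← Ideal.one_eq_top, one_pow]

omit [IsAlgClosed K] in
/-- Elements of the local ring at `a` are polynomials modulo powers of the maximal ideal. -/
theorem exists_sub_mem_map_pow (a : Fin 2 → K) (N : ℕ) (y : LocalRingAt a) :
    ∃ p : MvPolynomial (Fin 2) K, y - algebraMap _ _ p ∈
      (pointIdeal a ^ N).map (algebraMap _ (LocalRingAt a)) := by
  obtain ⟨h, s, rfl⟩ := IsLocalization.exists_mk'_eq (pointIdeal a).primeCompl y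
  have h1 : IsCoprime (Ideal.span {(s : MvPolynomial (Fin 2) K)}) (pointIdeal a) := by
    rw [Ideal.isCoprime_iff_sup_eq]
    exact (pointIdeal_isMaximal a).out.2 _ (right_lt_sup.mpr fun hle =>
      s.2 (hle (Ideal.mem_span_singleton_self _)))
  obtain ⟨u, hu, w, hw, e⟩ := Ideal.isCoprime_iff_exists.mp (h1.pow_right (n := N))
  obtain ⟨u, rfl⟩ := Ideal.mem_span_singleton.mp hu
  refine ⟨u * h, ?_⟩
  rw [← Ideal.mul_unit_mem_iff_mem _ (IsLocalization.map_units (LocalRingAt a) s), sub_mul,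
    IsLocalization.mk'_spec, ← map_mul, ← map_sub]
  apply Ideal.mem_map_of_mem
  have : h - u * h * s = h * w := by linear_combination (-h) * e
  rw [this]
  exact Ideal.mul_mem_left _ _ hw

theorem length_quotient_eq_sum_of_surjective {K P ι : Type*} [Field K] [CommRing P] [Algebra K P]
    [Fintype ι] {I : Ideal P} {O : ι → Type*} [∀ i, CommRing (O i)] [∀ i, Algebra P (O i)]
    [∀ i, Algebra K (O i)] [∀ i, IsScalarTower K P (O i)]
    (hs : ∀ z : ∀ i, O i, ∃ p : P, ∀ i, z i - algebraMap P (O i) p ∈ I.map (algebraMap P (O i)))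
    (hI : ∀ p, (∀ i, algebraMap P (O i) p ∈ I.map (algebraMap P (O i))) → p ∈ I) :
    Module.length K (P ⧸ I) = ∑ i, Module.length K (O i ⧸ I.map (algebraMap P (O i))) := by
  set f : P →ₐ[K] ∀ i, O i ⧸ I.map (algebraMap P (O i)) := AlgHom.pi fun i =>
    (Ideal.Quotient.mkₐ K _).comp (IsScalarTower.toAlgHom K P (O i))
  have hf : Function.Surjective f := fun y => by
    choose z hz using fun i => Ideal.Quotient.mk_surjective (y i)
    obtain ⟨p, hp⟩ := hs z
    refine ⟨p, funext fun i => ?_⟩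
    rw [← hz]
    exact ((Ideal.Quotient.eq).mpr (hp i)).symm
  have hker : I = RingHom.ker f := by
    ext p
    rw [RingHom.mem_ker]
    constructor
    · exact fun hp => funext fun i =>
        (Ideal.Quotient.eq_zero_iff_mem).mpr (Ideal.mem_map_of_mem _ hp)
    · exact fun hp => hI p fun i => (Ideal.Quotient.eq_zero_iff_mem).mp (congrFun hp i)
  rw [← Module.length_pi_of_fintype]
  exact ((Ideal.quotientEquivAlgOfEq K hker).trans
    (Ideal.quotientKerAlgEquivOfSurjective hf)).toLinearEquiv.length_eq

theorem exists_forall_sub_mem_map (Z : Finset (Fin 2 → K)) (hZ : ∀ a, a ∈ Z ↔ a ∈ zeroLocus K I)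
    (z : ∀ a : Z, LocalRingAt a.1) :
    ∃ p : MvPolynomial (Fin 2) K, ∀ a : Z, z a - algebraMap _ (LocalRingAt a.1) p ∈
      I.map (algebraMap _ (LocalRingAt a.1)) := by
  obtain ⟨N, hN⟩ := exists_prod_pow_le Z hZ
  choose p hp using fun a : Z => exists_sub_mem_map_pow a.1 N (z a)
  have hco : Pairwise (Function.onFun IsCoprime fun a : Z => pointIdeal a.1 ^ N) := by
    intro a b hab
    refine IsCoprime.pow (Ideal.isCoprime_of_isMaximal fun h => hab (Subtype.ext ?_))
    exact pointIdeal_injective h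
  obtain ⟨q, hq⟩ := Ideal.exists_forall_sub_mem_ideal hco p
  refine ⟨q, fun a => map_pointIdeal_pow_le hN a.2 ?_⟩
  have h1 := Ideal.mem_map_of_mem (algebraMap _ (LocalRingAt a.1)) (hq a)
  rw [map_sub] at h1
  have h2 := Ideal.sub_mem _ (hp a) h1
  rwa [sub_sub, add_sub_cancel] at h2

/-- It suffices to test membership in `I` at the zeros of `I`. -/
theorem mem_of_forall_mem_map (Z : Finset (Fin 2 → K))
    (hZ : ∀ a, a ∈ Z ↔ a ∈ zeroLocus K I) (h : MvPolynomial (Fin 2) K)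
    (hh : ∀ a : Z, algebraMap _ (LocalRingAt a.1) h ∈ I.map (algebraMap _ (LocalRingAt a.1))) :
    h ∈ I := by
  refine Ideal.mem_of_localization_maximal fun P hP => ?_
  obtain ⟨a, ha⟩ := isMaximal_iff_eq_vanishingIdeal_singleton.mp hP
  obtain rfl : P = pointIdeal a := by
    rw [ha]
    ext q
    rw [mem_vanishingIdeal_singleton_iff, aeval_eq_eval]
    rfl
  by_cases haZ : a ∈ Z
  · exact hh ⟨a, haZ⟩
  · have : ¬ I ≤ pointIdeal a := fun hle => haZ <| (hZ a).mpr <| (mem_zeroLocus_iff).mpr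
      fun q hq => by rw [aeval_eq_eval]; exact hle hq
    obtain ⟨s, hs, hs'⟩ := SetLike.not_le_iff_exists.mp this
    rw [Ideal.eq_top_of_isUnit_mem _ (Ideal.mem_map_of_mem (algebraMap _ (LocalRingAt a)) hs)
      (IsLocalization.map_units (LocalRingAt a) (⟨s, hs'⟩ : (pointIdeal a).primeCompl))]
    trivial

/-- A finite subscheme of the affine plane is the disjoint union of its local pieces. -/
theorem length_quotient_eq_sum (Z : Finset (Fin 2 → K)) (hZ : ∀ a, a ∈ Z ↔ a ∈ zeroLocus K I) :
    Module.length K (MvPolynomial (Fin 2) K ⧸ I) =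
      ∑ a ∈ Z, Module.length K
        (LocalRingAt a ⧸ I.map (algebraMap (MvPolynomial (Fin 2) K) (LocalRingAt a))) := by
  rw [← Finset.sum_coe_sort Z]
  exact length_quotient_eq_sum_of_surjective (O := fun a : Z => LocalRingAt a.1)
    (exists_forall_sub_mem_map Z hZ) (mem_of_forall_mem_map Z hZ)

end FiniteScheme

/-! ### Linear changes of coordinates -/

section LinearChange

variable {K : Type*} [Field K]

theorem pderiv_linSubst (M : Matrix (Fin 3) (Fin 3) K) (F : MvPolynomial (Fin 3) K) (j : Fin 3) :
    pderiv j (linSubst M F) = ∑ i, C (M i j) * linSubst M (pderiv i F) := by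
  unfold linSubst
  induction F using MvPolynomial.induction_on with
  | C c => simp
  | add p q hp hq => simp only [map_add, hp, hq, mul_add, Finset.sum_add_distrib]
  | mul_X p k hp =>
    have h1 : pderiv j (∑ l, C (M k l) * X l : MvPolynomial (Fin 3) K) = C (M k j) := by
      simp only [map_sum, pderiv_C_mul, pderiv_X]
      simp [Pi.single_apply]
    have h2 : ∀ i, (bind₁ fun i => ∑ j, C (M i j) * X j) (pderiv i (p * X k)) =
        (bind₁ fun i => ∑ j, C (M i j) * X j) (pderiv i p) * (∑ l, C (M k l) * X l) +
          if i = k then (bind₁ fun i => ∑ j, C (M i j) * X j) p else 0 := fun i => by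
      rw [pderiv_mul, map_add, map_mul, bind₁_X_right, map_mul, pderiv_X]
      by_cases h : i = k
      · subst h; simp
      · simp [h, Ne.symm h]
    rw [map_mul, bind₁_X_right, pderiv_mul, hp, h1]
    simp_rw [h2, mul_add, Finset.sum_add_distrib, Finset.sum_mul]
    simp only [mul_ite, mul_zero, Finset.sum_ite_eq', Finset.mem_univ, if_true]
    rw [mul_comm (C (M k j))]
    simp only [mul_assoc]

theorem exists_pderiv_linSubst_ne_zero {M : Matrix (Fin 3) (Fin 3) K} (hM : IsUnit M.det)
    {F : MvPolynomial (Fin 3) K} {v : Fin 3 → K} (h : ∃ i, eval (M *ᵥ v) (pderiv i F) ≠ 0) :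
    ∃ j, eval v (pderiv j (linSubst M F)) ≠ 0 := by
  by_contra! h0
  obtain ⟨i, hi⟩ := h
  have h1 : (fun i => eval (M *ᵥ v) (pderiv i F)) ᵥ* M = 0 := by
    funext j
    have := h0 j
    rw [pderiv_linSubst, map_sum] at this
    simp only [map_mul, eval_C, eval_linSubst] at this
    simpa [Matrix.vecMul, dotProduct, mul_comm] using this
  have h2 := congrArg (fun w => w ᵥ* M⁻¹) h1
  simp only [Matrix.vecMul_vecMul, Matrix.mul_nonsing_inv _ hM, Matrix.vecMul_one,
    Matrix.zero_vecMul] at h2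
  exact hi (congrFun h2 i)

theorem isRelPrime_linSubst {M : Matrix (Fin 3) (Fin 3) K} (hM : IsUnit M.det)
    {F G : MvPolynomial (Fin 3) K} (h : IsRelPrime F G) :
    IsRelPrime (linSubst M F) (linSubst M G) := by
  have key : ∀ {p H : MvPolynomial (Fin 3) K}, p ∣ linSubst M H → linSubst M⁻¹ p ∣ H := by
    rintro p H ⟨q, hq⟩
    refine ⟨linSubst M⁻¹ q, ?_⟩
    have := congrArg (linSubst M⁻¹) hq
    rw [linSubst_linSubst, Matrix.mul_nonsing_inv _ hM, linSubst_one] at this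
    rw [this, linSubst, map_mul, ← linSubst, ← linSubst]
  intro p hF hG
  have := h (key hF) (key hG)
  have := this.map (bind₁ fun i => ∑ j, C (M i j) * X j : _ →ₐ[K] MvPolynomial (Fin 3) K)
  change IsUnit (linSubst M (linSubst M⁻¹ p)) at this
  rwa [linSubst_linSubst, Matrix.nonsing_inv_mul _ hM, linSubst_one] at this

theorem linSubst_ne_zero {M : Matrix (Fin 3) (Fin 3) K} (hM : IsUnit M.det)
    {F : MvPolynomial (Fin 3) K} (h : F ≠ 0) : linSubst M F ≠ 0 := by
  intro h0
  have := congrArg (linSubst M⁻¹) h0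
  rw [linSubst_linSubst, Matrix.mul_nonsing_inv _ hM, linSubst_one, linSubst, map_zero] at this
  exact h this

end LinearChange

/-! ### Lines that avoid finitely many points -/

section Lines

/-- Finitely many points of the plane over `K` are avoided by one of the lines `x + t y + t² z = 0`
with `t ∈ k`: each point lies on at most two of them. -/
theorem exists_line_avoiding {k K : Type*} [Field k] [Field K] [Algebra k K]
    (s : Finset (Fin 3 → K)) (h0 : ∀ v ∈ s, v ≠ 0) (hk : Infinite k ∨ 2 * s.card < Nat.card k) :
    ∃ t : k, ∀ v ∈ s, v 0 + algebraMap k K t * v 1 + algebraMap k K t ^ 2 * v 2 ≠ 0 := by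
  classical
  let q : (Fin 3 → K) → Polynomial K := fun v =>
    Polynomial.C (v 2) * Polynomial.X ^ 2 + Polynomial.C (v 1) * Polynomial.X + Polynomial.C (v 0)
  have hq0 : ∀ v ∈ s, q v ≠ 0 := fun v hv h => h0 v hv <| by
    have h2 := congrArg (fun p => Polynomial.coeff p 2) h
    have h1 := congrArg (fun p => Polynomial.coeff p 1) h
    have h0 := congrArg (fun p => Polynomial.coeff p 0) h
    simp [q, Polynomial.coeff_X, Polynomial.coeff_C] at h0 h1 h2
    funext i
    fin_cases i <;> simp [h0, h1, h2]
  by_contra! hbad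
  let B := s.biUnion fun v => (q v).roots.toFinset
  have hB : B.card ≤ 2 * s.card := by
    rw [mul_comm]
    refine Finset.card_biUnion_le_card_mul _ _ _ fun v _ => ?_
    exact (Multiset.toFinset_card_le _).trans
      ((Polynomial.card_roots' _).trans Polynomial.natDegree_quadratic_le)
  have hmem : ∀ t : k, algebraMap k K t ∈ B := fun t => by
    obtain ⟨v, hv, e⟩ := hbad t
    refine Finset.mem_biUnion.mpr ⟨v, hv, ?_⟩
    rw [Multiset.mem_toFinset, Polynomial.mem_roots (hq0 v hv), Polynomial.IsRoot]
    simp only [q, Polynomial.eval_add, Polynomial.eval_mul, Polynomial.eval_C, Polynomial.eval_pow,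
      Polynomial.eval_X]
    linear_combination e
  have hinj : Function.Injective fun t : k => (⟨algebraMap k K t, hmem t⟩ : B) := fun a b h =>
    (algebraMap k K).injective (congrArg Subtype.val h)
  rcases hk with hk | hk
  · have := Finite.of_injective _ hinj
    exact not_finite k
  · have := Nat.card_le_card_of_injective _ hinj
    rw [Nat.card_eq_fintype_card (α := B), Fintype.card_coe] at this
    omega

/-- A linear change of coordinates which moves the line `x + t y + t² z = 0` to `z = 0`. -/
def lineMatrix {k : Type*} [Field k] (t : k) : Matrix (Fin 3) (Fin 3) k :=
  !![0, 0, 1; 0, 1, 0; 1, t, t ^ 2]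

theorem isUnit_det_lineMatrix {k : Type*} [Field k] (t : k) : IsUnit (lineMatrix t).det := by
  rw [lineMatrix, Matrix.det_fin_three]
  simp

theorem lineMatrix_mulVec {k : Type*} [Field k] (t : k) (v : Fin 3 → k) :
    (lineMatrix t *ᵥ v) 2 = v 0 + t * v 1 + t ^ 2 * v 2 := by
  simp [lineMatrix, Matrix.mulVec, dotProduct, Fin.sum_univ_three]

end Lines

/-! ### Intersection multiplicities on a smooth plane curve -/

section Projective

variable {K : Type*} [Field K] {F G : MvPolynomial (Fin 3) K} {m n : ℕ}

/-- The form `F` is the equation of a smooth plane curve over `K`. -/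
def IsSmoothForm (F : MvPolynomial (Fin 3) K) : Prop :=
  ∀ v : Fin 3 → K, v ≠ 0 → eval v F = 0 → ∃ i, eval v (pderiv i F) ≠ 0

theorem rep_chart_ne_zero (P : ℙ K (Fin 3 → K)) : P.rep (chart P) ≠ 0 :=
  (Function.ne_iff.mp P.rep_nonzero).choose_spec

theorem le_interMult_iff (hF : F.IsHomogeneous m) (hs : IsSmoothForm F) (hG : G.IsHomogeneous n)
    {P : ℙ K (Fin 3 → K)} (hP : eval P.rep F = 0) (r : ℕ) :
    (r : ℕ∞) ≤ interMult F G P ↔ MultGe F G P.rep r :=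
  le_localMult_dehom_iff (rep_chart_ne_zero P) hF hG hP (hs _ P.rep_nonzero hP)

/-- Intersection multiplicities on a smooth curve do not depend on coordinates and charts. -/
theorem interMult_eq_localMult (hF : F.IsHomogeneous m) (hs : IsSmoothForm F)
    (hG : G.IsHomogeneous n) {P : ℙ K (Fin 3 → K)} (hP : eval P.rep F = 0)
    {M : Matrix (Fin 3) (Fin 3) K} (hM : IsUnit M.det) {i : Fin 3}
    (hi : (M⁻¹ *ᵥ P.rep) i ≠ 0) :
    interMult F G P = localMult (dehom i (linSubst M F)) (dehom i (linSubst M G))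
      (affinePt i (M⁻¹ *ᵥ P.rep)) := by
  have hMv : M *ᵥ (M⁻¹ *ᵥ P.rep) = P.rep := by
    rw [Matrix.mulVec_mulVec, Matrix.mul_nonsing_inv _ hM, Matrix.one_mulVec]
  refine ENat.eq_of_forall_natCast_le_iff fun r => ?_
  rw [le_interMult_iff hF hs hG hP, le_localMult_dehom_iff hi (isHomogeneous_linSubst M hF)
    (isHomogeneous_linSubst M hG) (by rw [eval_linSubst, hMv, hP]), multGe_linSubst_iff hM, hMv]
  refine exists_pderiv_linSubst_ne_zero hM ?_
  rw [hMv]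
  exact hs _ P.rep_nonzero hP

theorem interMult_mul (hF : F.IsHomogeneous m) (hs : IsSmoothForm F) {P : ℙ K (Fin 3 → K)}
    (hP : eval P.rep F = 0) (G H : MvPolynomial (Fin 3) K) :
    interMult F (G * H) P = interMult F G P + interMult F H P := by
  have h := localMult_mul ((eval_dehom_eq_zero_iff (rep_chart_ne_zero P) hF).mpr hP)
    (exists_pderiv_dehom_ne_zero (rep_chart_ne_zero P) hF hP (hs _ P.rep_nonzero hP))
    (dehom (chart P) G) (dehom (chart P) H)
  have e : dehom (chart P) (G * H) = dehom (chart P) G * dehom (chart P) H := map_mul _ _ _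
  rw [← e] at h
  exact h

theorem exists_smul_eq_of_affinePt_eq {v w : Fin 3 → K} {i : Fin 3} (hv : v i ≠ 0) (hw : w i ≠ 0)
    (h : affinePt i v = affinePt i w) : (v i / w i) • w = v := by
  funext l
  rcases Fin.eq_self_or_eq_succAbove i l with rfl | ⟨l, rfl⟩
  · simp [div_mul_cancel₀ _ hw]
  · have := congrFun h l
    simp only [affinePt] at this
    rw [Pi.smul_apply, smul_eq_mul]
    field_simp at this ⊢
    linear_combination -this

theorem eq_of_affinePt_eq {N : Matrix (Fin 3) (Fin 3) K} (hN : IsUnit N.det) {i : Fin 3}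
    {P Q : ℙ K (Fin 3 → K)} (hP : (N *ᵥ P.rep) i ≠ 0) (hQ : (N *ᵥ Q.rep) i ≠ 0)
    (h : affinePt i (N *ᵥ P.rep) = affinePt i (N *ᵥ Q.rep)) : P = Q := by
  have h1 := exists_smul_eq_of_affinePt_eq hP hQ h
  rw [← Matrix.mulVec_smul] at h1
  have h2 := congrArg (fun w => N⁻¹ *ᵥ w) h1
  simp only [Matrix.mulVec_mulVec, Matrix.nonsing_inv_mul _ hN, Matrix.one_mulVec] at h2
  rw [← P.mk_rep, ← Q.mk_rep, Projectivization.mk_eq_mk_iff']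
  exact ⟨_, h2⟩

section Bezout

variable (hF : F.IsHomogeneous m) (hG : G.IsHomogeneous n) (hF0 : F ≠ 0) (hG0 : G ≠ 0)
  (hc : IsRelPrime F G)

include hF hG hF0 hG0 hc

theorem finite_common_zeros :
    {P : ℙ K (Fin 3 → K) | eval P.rep F = 0 ∧ eval P.rep G = 0}.Finite := by
  have hfin : ∀ i : Fin 3, (zeroLocus K (Ideal.span {dehom i F, dehom i G})).Finite := fun i => by
    have := finite_affineInter i hF hG hF0 hG0 hc
    exact finite_zeroLocus
  refine Set.Finite.of_finite_image
    (f := fun P : ℙ K (Fin 3 → K) => (chart P, affineCoords P)) ?_ ?_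
  · refine (Set.finite_univ.prod (Set.finite_iUnion hfin)).subset ?_
    rintro _ ⟨P, ⟨h1, h2⟩, rfl⟩
    refine ⟨trivial, Set.mem_iUnion.mpr ⟨chart P, ?_⟩⟩
    rw [zeroLocus_span]
    rintro _ (rfl | rfl)
    · rw [aeval_eq_eval]
      exact (eval_dehom_eq_zero_iff (rep_chart_ne_zero P) hF).mpr h1
    · rw [aeval_eq_eval]
      exact (eval_dehom_eq_zero_iff (rep_chart_ne_zero P) hG).mpr h2
  · intro P _ Q _ h
    obtain ⟨h1, h2⟩ := Prod.mk.inj h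
    refine eq_of_affinePt_eq (N := 1) (i := chart P) (by simp) ?_ ?_ ?_
    · rw [Matrix.one_mulVec]; exact rep_chart_ne_zero P
    · rw [Matrix.one_mulVec, h1]; exact rep_chart_ne_zero Q
    · rw [Matrix.one_mulVec, Matrix.one_mulVec]
      have e : affinePt (chart Q) Q.rep = affinePt (chart P) Q.rep := by rw [h1]
      exact h2.trans e

/-- **Bézout's theorem** for a smooth plane curve. A line that avoids the intersection is moved to
`z = 0`, and the coordinate ring of the affine part is decomposed into its local pieces. -/
theorem sum_interMult [IsAlgClosed K] (hs : IsSmoothForm F) (hm : m ≠ 0)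
    (Z : Finset (ℙ K (Fin 3 → K)))
    (hZ : ∀ P, P ∈ Z ↔ eval P.rep F = 0 ∧ eval P.rep G = 0) :
    ∑ P ∈ Z, interMult F G P = (m * n : ℕ) := by
  classical
  obtain ⟨t, ht⟩ := exists_line_avoiding (k := K) (Z.image Projectivization.rep) (fun v hv => by
    obtain ⟨P, -, rfl⟩ := Finset.mem_image.mp hv
    exact P.rep_nonzero) (Or.inl inferInstance)
  have hN := isUnit_det_lineMatrix t
  set N := lineMatrix t with hNdef
  have hMdet : IsUnit (N⁻¹).det := Matrix.isUnit_nonsing_inv_det N hN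
  have hMinv : (N⁻¹)⁻¹ = N := Matrix.nonsing_inv_nonsing_inv N hN
  have hMN : ∀ v : Fin 3 → K, N⁻¹ *ᵥ (N *ᵥ v) = v := fun v => by
    rw [Matrix.mulVec_mulVec, Matrix.nonsing_inv_mul _ hN, Matrix.one_mulVec]
  have hNM : ∀ v : Fin 3 → K, N *ᵥ (N⁻¹ *ᵥ v) = v := fun v => by
    rw [Matrix.mulVec_mulVec, Matrix.mul_nonsing_inv _ hN, Matrix.one_mulVec]
  have hZN : ∀ P ∈ Z, (N *ᵥ P.rep) 2 ≠ 0 := fun P hP => by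
    rw [hNdef, lineMatrix_mulVec]
    exact ht _ (Finset.mem_image_of_mem _ hP)
  set F' := linSubst N⁻¹ F
  set G' := linSubst N⁻¹ G
  have hF' : F'.IsHomogeneous m := isHomogeneous_linSubst _ hF
  have hG' : G'.IsHomogeneous n := isHomogeneous_linSubst _ hG
  have hF0' : F' ≠ 0 := linSubst_ne_zero hMdet hF0
  have hG0' : G' ≠ 0 := linSubst_ne_zero hMdet hG0
  have hc' : IsRelPrime F' G' := isRelPrime_linSubst hMdet hc
  -- A common zero `v` of the transformed curves is a multiple of `N P` for a point `P` of `Z`.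
  have hpt : ∀ v : Fin 3 → K, v ≠ 0 → eval v F' = 0 → eval v G' = 0 →
      ∃ P ∈ Z, ∃ c : K, c ≠ 0 ∧ v = c • (N *ᵥ P.rep) := fun v hv h1 h2 => by
    have hw : N⁻¹ *ᵥ v ≠ 0 := fun h => hv (by rw [← hNM v, h, Matrix.mulVec_zero])
    obtain ⟨c, hc⟩ := Projectivization.exists_smul_eq_mk_rep K _ hw
    rw [eval_linSubst] at h1 h2
    refine ⟨Projectivization.mk K _ hw, (hZ _).mpr ?_, ((c⁻¹ : Kˣ) : K), (c⁻¹).ne_zero, ?_⟩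
    · rw [← hc, Units.smul_def, eval_smul_of_isHomogeneous hF, eval_smul_of_isHomogeneous hG, h1,
        h2, mul_zero, mul_zero]
      exact ⟨rfl, rfl⟩
    · rw [← hc, Units.smul_def, Matrix.mulVec_smul, hNM, smul_smul, Units.inv_mul, one_smul]
  have hX : ∀ H : MvPolynomial (Fin 3) K, X 2 * H ∈ Ideal.span {F', G'} →
      H ∈ Ideal.span {F', G'} := fun H hH => by
    refine mem_span_pair_of_X_mul_mem 2 (fun v hv hv2 h1 h2 => ?_) ?_ hH
    · obtain ⟨P, hP, c, hc0, rfl⟩ := hpt v hv h1 h2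
      exact (mul_ne_zero hc0 (hZN P hP)) hv2
    · have := eval_smul_of_isHomogeneous hF' 0 0
      rwa [zero_smul, zero_pow hm, zero_mul] at this
  have hfin := finite_affineInter 2 hF' hG' hF0' hG0' hc'
  have hrank := finrank_affineInter 2 hF' hG' hF0' hG0' hc' hX
  have hZ2 : (zeroLocus K (Ideal.span {dehom 2 F', dehom 2 G'})).Finite := finite_zeroLocus
  have hsum := length_quotient_eq_sum hZ2.toFinset (fun a => hZ2.mem_toFinset)
  rw [Module.length_eq_finrank, hrank] at hsum
  rw [hsum]
  have hmemZ2 : ∀ a, a ∈ hZ2.toFinset ↔ eval a (dehom 2 F') = 0 ∧ eval a (dehom 2 G') = 0 := by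
    intro a
    rw [hZ2.mem_toFinset, zeroLocus_span]
    simp [aeval_eq_eval]
  refine Finset.sum_bij (fun P _ => affinePt 2 (N *ᵥ P.rep)) ?_ ?_ ?_ ?_
  · intro P hP
    have h12 := (hZ P).mp hP
    rw [hmemZ2, eval_dehom_eq_zero_iff (hZN P hP) hF', eval_dehom_eq_zero_iff (hZN P hP) hG',
      eval_linSubst, eval_linSubst, hMN]
    exact h12
  · intro P hP Q hQ h
    exact eq_of_affinePt_eq hN (hZN P hP) (hZN Q hQ) h
  · intro a ha
    set v : Fin 3 → K := (2 : Fin 3).insertNth (α := fun _ => K) 1 a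
    have hv2 : v 2 = 1 := by simp [v]
    have hav : affinePt 2 v = a := by
      funext j
      rw [affinePt, hv2, div_one]
      simp [v]
    have hv2' : v 2 ≠ 0 := by rw [hv2]; exact one_ne_zero
    rw [hmemZ2, ← hav, eval_dehom_eq_zero_iff hv2' hF', eval_dehom_eq_zero_iff hv2' hG'] at ha
    obtain ⟨P, hP, c, hc0, e⟩ := hpt v (fun h => hv2' (by rw [h]; rfl)) ha.1 ha.2
    refine ⟨P, hP, ?_⟩
    rw [← hav, e]
    funext j
    simp only [affinePt, Pi.smul_apply, smul_eq_mul]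
    rw [mul_div_mul_left _ _ hc0]
  · intro P hP
    have := interMult_eq_localMult hF hs hG ((hZ P).mp hP).1 hMdet (i := 2)
      (by rw [hMinv]; exact hZN P hP)
    rw [hMinv] at this
    exact this

end Bezout

end Projective

/-! ### Descent and a dimension count -/

section Descent

/-- Galois descent: take a nonzero element with the fewest monomials and normalize one of its
coefficients. The difference with any conjugate has fewer monomials, hence is zero. -/
theorem exists_map_mem_of_stable {k K σ : Type*} [Field k] [Field K] [Algebra k K] [IsGalois k K]
    (W : Submodule K (MvPolynomial σ K))
    (hW : ∀ τ : K ≃ₐ[k] K, ∀ p ∈ W, map (τ : K →+* K) p ∈ W) (h0 : ∃ p ∈ W, p ≠ 0) :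
    ∃ q : MvPolynomial σ k, q ≠ 0 ∧ map (algebraMap k K) q ∈ W := by
  classical
  obtain ⟨p, ⟨hpW, hp0⟩, hmin⟩ := WellFounded.has_min
    (measure fun p : MvPolynomial σ K => p.support.card).wf {p | p ∈ W ∧ p ≠ 0} h0
  obtain ⟨m, hm⟩ := support_nonempty.mpr hp0
  rw [mem_support_iff] at hm
  set r := C (coeff m p)⁻¹ * p with hr
  have hcr : ∀ n, coeff n r = (coeff m p)⁻¹ * coeff n p := fun n => coeff_C_mul n _ p
  have hrW : r ∈ W := by
    rw [hr, ← smul_eq_C_mul]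
    exact W.smul_mem _ hpW
  have hrm : coeff m r = 1 := by rw [hcr, inv_mul_cancel₀ hm]
  have hfix : ∀ τ : K ≃ₐ[k] K, map (τ : K →+* K) r = r := fun τ => by
    by_contra hne
    refine hmin (map (τ : K →+* K) r - r) ⟨W.sub_mem (hW τ r hrW) hrW, sub_ne_zero.mpr hne⟩ ?_
    refine Finset.card_lt_card (Finset.ssubset_iff_subset_ne.mpr ⟨fun n hn => ?_, fun h => ?_⟩)
    · rw [mem_support_iff] at hn ⊢
      refine fun h => hn ?_
      rw [coeff_sub, coeff_map, hcr, h, mul_zero, map_zero, sub_zero]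
    · have : m ∈ p.support := mem_support_iff.mpr hm
      rw [← h, mem_support_iff, coeff_sub, coeff_map, hrm, map_one, sub_self] at this
      exact this rfl
  have hrange : r ∈ Set.range (map (σ := σ) (algebraMap k K)) := by
    rw [mem_range_map_iff_coeffs_subset]
    intro c hc
    obtain ⟨n, -, rfl⟩ := mem_coeffs_iff.mp hc
    refine (InfiniteGalois.mem_range_algebraMap_iff_fixed _).mpr fun τ => ?_
    have := congrArg (coeff n) (hfix τ)
    rwa [coeff_map] at this
  obtain ⟨q, hq⟩ := hrange
  refine ⟨q, ?_, hq ▸ hrW⟩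
  rintro rfl
  rw [map_zero] at hq
  rw [← hq, coeff_zero] at hrm
  exact zero_ne_one hrm

/-- Imposing fewer linear conditions than the dimension of `V` leaves a nonzero solution. -/
theorem exists_ne_zero_forall_mem {K V ι : Type*} [Field K] [AddCommGroup V] [Module K V]
    [Module.Finite K V] (s : Finset ι) (O : ι → Type*) [∀ i, CommRing (O i)]
    [∀ i, Algebra K (O i)] (J : ∀ i, Ideal (O i)) (d : ι → ℕ)
    (hd : ∀ i ∈ s, Module.length K (O i ⧸ J i) = d i) (φ : ∀ i, V →ₗ[K] O i)
    (h : ∑ i ∈ s, d i < Module.finrank K V) : ∃ v ≠ 0, ∀ i ∈ s, φ i v ∈ J i := by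
  let Φ : V →ₗ[K] ∀ i : s, O i ⧸ J i :=
    LinearMap.pi fun i => (Ideal.Quotient.mkₐ K (J i)).toLinearMap ∘ₗ φ i
  by_contra! hne
  have hinj : Function.Injective Φ := by
    rw [← LinearMap.ker_eq_bot, LinearMap.ker_eq_bot']
    intro v hv
    by_contra hv0
    obtain ⟨i, hi, h1⟩ := hne v hv0
    exact h1 (Ideal.Quotient.eq_zero_iff_mem.mp (congrFun hv ⟨i, hi⟩))
  have h1 := Module.length_le_of_injective Φ hinj
  rw [Module.length_eq_finrank, Module.length_pi_of_fintype] at h1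
  have h2 : ∑ i : s, Module.length K (O i ⧸ J i) = ((∑ i ∈ s, d i : ℕ) : ℕ∞) := by
    rw [Nat.cast_sum, ← Finset.sum_coe_sort s]
    exact Finset.sum_congr rfl fun i _ => hd i i.2
  rw [h2, Nat.cast_le] at h1
  omega

end Descent

/-! ### Intersection divisors on a smooth plane quartic -/

section Quartic

variable {k K : Type*} [Field k] [Field K] [Algebra k K] {f : MvPolynomial (Fin 3) k}

theorem eval_map_algebraMap (v : Fin 3 → K) (q : MvPolynomial (Fin 3) k) :
    eval v (map (algebraMap k K) q) = aeval v q := by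
  rw [eval_map, aeval_def]

theorem map_algebraMap_ne_zero {σ : Type*} {q : MvPolynomial σ k} (hq : q ≠ 0) :
    map (algebraMap k K) q ≠ 0 := fun h =>
  hq (map_injective _ (algebraMap k K).injective (h.trans (map_zero _).symm))

theorem CurvePoint.eval_eq_zero (P : CurvePoint K f) :
    eval P.1.rep (map (algebraMap k K) f) = 0 := by
  rw [eval_map_algebraMap]
  exact P.2

theorem CurvePoint.val_injective : Function.Injective fun P : CurvePoint K f => P.1 :=
  fun _ _ h => Subtype.ext h

variable (hf : IsSmoothPlaneQuartic K f)

include hf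

theorem IsSmoothPlaneQuartic.isSmoothForm : IsSmoothForm (map (algebraMap k K) f) := by
  intro v hv h
  rw [eval_map_algebraMap] at h
  obtain ⟨i, hi⟩ := hf.2 v hv h
  exact ⟨i, by rwa [pderiv_map, eval_map_algebraMap]⟩

theorem IsSmoothPlaneQuartic.ne_zero : f ≠ 0 := by
  rintro rfl
  obtain ⟨i, hi⟩ := hf.2 1 one_ne_zero (map_zero _)
  exact hi (by simp)

theorem IsSmoothPlaneQuartic.isHomogeneous : (map (algebraMap k K) f).IsHomogeneous 4 :=
  hf.1.map _

theorem IsSmoothPlaneQuartic.le_multAt_iff {G : MvPolynomial (Fin 3) k} {n : ℕ}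
    (hG : G.IsHomogeneous n) (P : CurvePoint K f) (r : ℕ) :
    (r : ℕ∞) ≤ multAt f G P ↔
      MultGe (map (algebraMap k K) f) (map (algebraMap k K) G) P.1.rep r :=
  le_interMult_iff hf.isHomogeneous hf.isSmoothForm (hG.map _) P.eval_eq_zero r

theorem IsSmoothPlaneQuartic.interGe_iff {G : MvPolynomial (Fin 3) k} {n : ℕ}
    (hG : G.IsHomogeneous n) (S : CurvePoint K f →₀ ℕ) :
    InterGe f G S ↔ ∀ P ∈ S.support,
      MultGe (map (algebraMap k K) f) (map (algebraMap k K) G) P.1.rep (S P) := by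
  refine ⟨fun h P _ => (hf.le_multAt_iff hG P _).mp (h P), fun h P => ?_⟩
  by_cases hP : P ∈ S.support
  · exact (hf.le_multAt_iff hG P _).mpr (h P hP)
  · rw [Finsupp.notMem_support_iff.mp hP, Nat.cast_zero]
    exact zero_le

/-- Bézout's theorem, for curves that cannot contain the quartic for degree reasons. -/
theorem IsSmoothPlaneQuartic.exists_interEq [IsAlgClosed K] {G : MvPolynomial (Fin 3) k} {n : ℕ}
    (hG : G.IsHomogeneous n) (hG0 : G ≠ 0) (hn : n < 4) :
    ∃ A : CurvePoint K f →₀ ℕ, InterEq f G A ∧ A.degree = 4 * n := by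
  classical
  have hF0 := map_algebraMap_ne_zero (K := K) hf.ne_zero
  have hG0' := map_algebraMap_ne_zero (K := K) hG0
  have hG' := hG.map (algebraMap k K)
  have hc := isRelPrime_of_smooth hf.isHomogeneous hf.isSmoothForm hF0 hG' hG0' hn
  have hfin := finite_common_zeros hf.isHomogeneous hG' hF0 hG0' hc
  have hsum := sum_interMult hf.isHomogeneous hG' hF0 hG0' hc hf.isSmoothForm four_ne_zero
    hfin.toFinset (fun P => by rw [hfin.mem_toFinset]; rfl)
  have hzero : ∀ P : CurvePoint K f, P.1 ∉ hfin.toFinset → multAt f G P = 0 := fun P hP => by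
    by_contra h
    refine hP (hfin.mem_toFinset.mpr ⟨P.eval_eq_zero, ?_⟩)
    exact ((hf.le_multAt_iff hG P 1).mp (by
      rw [Nat.cast_one]; exact Order.one_le_iff_ne_zero.mpr h)).eval_eq_zero P.eval_eq_zero
        one_ne_zero
  have htop : ∀ P : CurvePoint K f, multAt f G P ≠ ⊤ := fun P h => by
    have hP : P.1 ∈ hfin.toFinset := by
      by_contra hP
      rw [hzero P hP] at h
      exact ENat.zero_ne_top h
    have h1 := Finset.single_le_sum_of_canonicallyOrdered
      (f := interMult (map (algebraMap k K) f) (map (algebraMap k K) G)) hP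
    rw [hsum] at h1
    rw [show interMult _ _ P.1 = ⊤ from h, top_le_iff] at h1
    exact ENat.natCast_ne_top _ h1
  have hsupp : (Function.support fun P : CurvePoint K f => (multAt f G P).toNat).Finite := by
    refine Set.Finite.of_finite_image (f := fun P : CurvePoint K f => P.1) (hfin.subset ?_)
      CurvePoint.val_injective.injOn
    rintro _ ⟨P, hP, rfl⟩
    by_contra h
    exact hP (by simp only [hzero P (fun h' => h (hfin.mem_toFinset.mp h')), ENat.toNat_zero])
  set A : CurvePoint K f →₀ ℕ := Finsupp.ofSupportFinite _ hsupp with hA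
  have hAP : ∀ P, (A P : ℕ∞) = multAt f G P := fun P => ENat.natCast_toNat (htop P)
  refine ⟨A, fun P => (hAP P).symm, ?_⟩
  have h1 : ∑ P ∈ A.support.map ⟨_, CurvePoint.val_injective⟩,
      interMult (map (algebraMap k K) f) (map (algebraMap k K) G) P = (4 * n : ℕ) := by
    rw [← hsum]
    refine Finset.sum_subset (fun P hP => ?_) fun P hP hP' => ?_
    · obtain ⟨R, hR, rfl⟩ := Finset.mem_map.mp hP
      by_contra h
      refine Finsupp.mem_support_iff.mp hR ?_
      have := hAP R
      rwa [hzero R h, Nat.cast_eq_zero] at this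
    · have h2 := (hfin.mem_toFinset.mp hP).1
      rw [eval_map_algebraMap] at h2
      obtain ⟨R, rfl⟩ : ∃ R : CurvePoint K f, R.1 = P := ⟨⟨P, h2⟩, rfl⟩
      have h3 : R ∉ A.support := fun h => hP' (Finset.mem_map.mpr ⟨_, h, rfl⟩)
      rw [Finsupp.notMem_support_iff] at h3
      have := hAP R
      rw [h3, Nat.cast_zero] at this
      exact this.symm
  rw [Finset.sum_map] at h1
  rw [Finsupp.degree_apply, ← Nat.cast_inj (R := ℕ∞), ← h1, Nat.cast_sum]
  exact Finset.sum_congr rfl fun P _ => hAP P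

/-- There is a form over `K` whose intersection with the curve contains a given divisor, provided that
there are more monomials of degree `d` than conditions. -/
theorem IsSmoothPlaneQuartic.exists_form_multGe (S : CurvePoint K f →₀ ℕ) {d : ℕ}
    (hd : S.degree < (d + 2).choose 2) :
    ∃ G : MvPolynomial (Fin 3) K, G.IsHomogeneous d ∧ G ≠ 0 ∧
      ∀ P ∈ S.support, MultGe (map (algebraMap k K) f) G P.1.rep (S P) := by
  obtain ⟨G, hG0, hG⟩ := exists_ne_zero_forall_mem (K := K) (V := Forms K d) S.support
    (fun P => LocalRingAt (affineCoords P.1))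
    (fun P => Ideal.map (algebraMap (MvPolynomial (Fin 2) K) (LocalRingAt (affineCoords P.1)))
      (Ideal.span {dehom (chart P.1) (map (algebraMap k K) f)} ⊔
        pointIdeal (affineCoords P.1) ^ S P)) S
    (fun P _ => length_quotient_sup_pow
      ((eval_dehom_eq_zero_iff (rep_chart_ne_zero P.1) hf.isHomogeneous).mpr P.eval_eq_zero)
      (exists_pderiv_dehom_ne_zero (rep_chart_ne_zero P.1) hf.isHomogeneous P.eval_eq_zero
        (hf.isSmoothForm _ P.1.rep_nonzero P.eval_eq_zero)) (S P))
    (fun P => (IsScalarTower.toAlgHom K (MvPolynomial (Fin 2) K)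
      (LocalRingAt (affineCoords P.1))).toLinearMap ∘ₗ (aeval (R := K)
        ((chart P.1).insertNth (α := fun _ => MvPolynomial (Fin 2) K) 1 X)).toLinearMap ∘ₗ
          (Forms K d).subtype)
    (by rwa [finrank_forms, ← Finsupp.degree_apply])
  refine ⟨G, G.2, fun h => hG0 (Subtype.ext h), fun P hP => ?_⟩
  refine multGe_of_dehom_mem (rep_chart_ne_zero P.1) hf.isHomogeneous G.2 ?_
  exact (mem_sup_pow_iff_mem_localization _ _ _).mp (hG P hP)

end Quartic

/-! ### The Galois action -/

section Galois

variable {k K : Type*} [Field k] [Field K] [Algebra k K]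

theorem exists_smul_eq_galConj_rep (σ : K ≃ₐ[k] K) (P : ℙ K (Fin 3 → K)) :
    ∃ c : K, c ≠ 0 ∧ (galConj σ P).rep = c • fun i => σ (P.rep i) := by
  obtain ⟨c, hc⟩ := Projectivization.exists_smul_eq_mk_rep K _ (conj_rep_ne_zero σ P)
  exact ⟨c, c.ne_zero, hc.symm⟩

theorem galConj_symm_galConj (σ : K ≃ₐ[k] K) (P : ℙ K (Fin 3 → K)) :
    galConj σ.symm (galConj σ P) = P := by
  obtain ⟨c, -, hc⟩ := exists_smul_eq_galConj_rep σ P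
  conv_rhs => rw [← P.mk_rep]
  rw [galConj, Projectivization.mk_eq_mk_iff']
  refine ⟨σ.symm c, funext fun i => ?_⟩
  simp [hc]

theorem galConj_eq_self {P : ℙ K (Fin 3 → K)} (hP : IsRationalPoint k P) (σ : K ≃ₐ[k] K) :
    galConj σ P = P := by
  obtain ⟨v, hv, rfl⟩ := hP
  obtain ⟨c, hc⟩ := Projectivization.exists_smul_eq_mk_rep K _ hv
  set R := Projectivization.mk K (fun i => algebraMap k K (v i)) hv
  conv_rhs => rw [← R.mk_rep]
  rw [galConj, Projectivization.mk_eq_mk_iff']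
  refine ⟨σ c * (c : K)⁻¹, funext fun i => ?_⟩
  have h : R.rep i = c * algebraMap k K (v i) := (congrFun hc i).symm
  rw [Pi.smul_apply, h, smul_eq_mul, map_mul, AlgEquiv.commutes]
  have := c.ne_zero
  field_simp

variable {f : MvPolynomial (Fin 3) k} {G : MvPolynomial (Fin 3) K} {n : ℕ}

theorem map_map_algebraMap {ι : Type*} (σ : K ≃ₐ[k] K) (q : MvPolynomial ι k) :
    map (σ : K →+* K) (map (algebraMap k K) q) = map (algebraMap k K) q := by
  rw [map_map]
  congr 2
  exact AlgHom.comp_algebraMap σ.toAlgHom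

theorem MultGe.galConj (σ : K ≃ₐ[k] K) {P : ℙ K (Fin 3 → K)}
    (h : MultGe (MvPolynomial.map (algebraMap k K) f) G P.rep n) :
    MultGe (MvPolynomial.map (algebraMap k K) f) (MvPolynomial.map (σ : K →+* K) G)
      (galConj σ P).rep n := by
  obtain ⟨c, hc0, hc⟩ := exists_smul_eq_galConj_rep σ P
  have h1 := h.map (σ : K →+* K)
  rw [map_map_algebraMap] at h1
  rw [hc]
  exact h1.smul hc0

/-- The inequality for `σ` and the one for its inverse give equality. -/
theorem GaloisStable.of_le {M : Type*} [Zero M] [PartialOrder M] {D : CurvePoint K f →₀ M}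
    (h : ∀ (σ : K ≃ₐ[k] K) (P P' : CurvePoint K f), P'.1 = _root_.galConj σ P.1 → D P ≤ D P') :
    GaloisStable D := fun σ P P' hP =>
  le_antisymm (h σ P P' hP) (h σ.symm P' P (by rw [hP, galConj_symm_galConj]))

theorem GaloisStable.single {M : Type*} [Zero M] {P : CurvePoint K f}
    (hP : IsRationalPoint k P.1) (m : M) : GaloisStable (Finsupp.single P m) := by
  classical
  intro σ R R' h
  have : R = P ↔ R' = P := by
    constructor
    · rintro rfl
      exact Subtype.ext (h.trans (galConj_eq_self hP σ))
    · rintro rfl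
      refine Subtype.ext ?_
      rw [← galConj_symm_galConj σ R.1, ← h, galConj_eq_self hP]
  rw [Finsupp.single_apply, Finsupp.single_apply]
  exact if_congr (by rw [eq_comm, this, eq_comm]) rfl rfl

theorem GaloisStable.add {M : Type*} [AddZeroClass M] {D E : CurvePoint K f →₀ M}
    (hD : GaloisStable D) (hE : GaloisStable E) : GaloisStable (D + E) := fun σ P P' h => by
  rw [Finsupp.add_apply, Finsupp.add_apply, hD σ P P' h, hE σ P P' h]

theorem GaloisStable.of_add_left {D E : CurvePoint K f →₀ ℕ} (hD : GaloisStable D)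
    (hDE : GaloisStable (D + E)) : GaloisStable E := fun σ P P' h => by
  have h1 := hDE σ P P' h
  have h2 := hD σ P P' h
  rw [Finsupp.add_apply, Finsupp.add_apply] at h1
  omega

theorem GaloisStable.toDiv {D : CurvePoint K f →₀ ℕ} (hD : GaloisStable D) :
    GaloisStable (toDiv D) := fun σ P P' h => congrArg Nat.cast (hD σ P P' h)

theorem toDiv_add (D E : CurvePoint K f →₀ ℕ) : toDiv (D + E) = toDiv D + toDiv E :=
  Finsupp.ext fun P => Nat.cast_add (D P) (E P)

theorem degree_toDiv (D : CurvePoint K f →₀ ℕ) : (toDiv D).degree = D.degree := by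
  rw [Finsupp.degree_apply, Finsupp.degree_apply, Nat.cast_sum, _root_.toDiv,
    Finsupp.support_mapRange_of_injective _ _ Nat.cast_injective]
  rfl

variable (hf : IsSmoothPlaneQuartic K f)

include hf

theorem IsSmoothPlaneQuartic.galoisStable_of_interEq {Q : MvPolynomial (Fin 3) k} {d : ℕ}
    (hQ : Q.IsHomogeneous d) {A : CurvePoint K f →₀ ℕ} (hA : InterEq f Q A) : GaloisStable A :=
  GaloisStable.of_le fun σ P P' h => by
    have h1 := (hf.le_multAt_iff hQ P (A P)).mp (hA P).ge
    have h2 := h1.galConj σ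
    rw [map_map_algebraMap, ← h] at h2
    have h3 := (hf.le_multAt_iff hQ P' (A P)).mpr h2
    rwa [hA P', Nat.cast_le] at h3

/-- There is a form over the base field whose intersection with the curve contains a given
Galois stable divisor, provided that there are more monomials than conditions. -/
theorem IsSmoothPlaneQuartic.exists_interGe [IsGalois k K] {S : CurvePoint K f →₀ ℕ}
    (hS : GaloisStable S) {d : ℕ} (hd : S.degree < (d + 2).choose 2) :
    ∃ Q : MvPolynomial (Fin 3) k, Q.IsHomogeneous d ∧ Q ≠ 0 ∧ InterGe f Q S := by
  set F := map (algebraMap k K) f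
  let W : Submodule K (MvPolynomial (Fin 3) K) :=
    { carrier := {G | G.IsHomogeneous d ∧ ∀ P ∈ S.support, MultGe F G P.1.rep (S P)}
      zero_mem' := ⟨isHomogeneous_zero _ _ _, fun _ _ => MultGe.zero_right _ _ _⟩
      add_mem' := fun ha hb => ⟨ha.1.add hb.1, fun P hP => (ha.2 P hP).add (hb.2 P hP)⟩
      smul_mem' := fun c G hG => by
        rw [smul_eq_C_mul]
        exact ⟨hG.1.C_mul c, fun P hP => (hG.2 P hP).mul_left _⟩ }
  -- The condition on a conjugate form at `P` is the condition on the form at the conjugate point,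
  -- where `S` has the same multiplicity.
  have hstable : ∀ τ : K ≃ₐ[k] K, ∀ G ∈ W, map (τ : K →+* K) G ∈ W := fun τ G hG => by
    refine ⟨hG.1.map _, fun P hP => ?_⟩
    have hR : aeval (galConj τ.symm P.1).rep f = 0 := by
      rw [← eval_map_algebraMap]
      obtain ⟨c, -, hc⟩ := exists_smul_eq_galConj_rep τ.symm P.1
      rw [hc, eval_smul_of_isHomogeneous hf.isHomogeneous, ← map_map_algebraMap τ.symm f]
      have := map_eval (τ.symm : K →+* K) P.1.rep F
      rw [P.eval_eq_zero, map_zero] at this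
      exact mul_eq_zero_of_right _ this.symm
    obtain ⟨R, hRP⟩ : ∃ R : CurvePoint K f, R.1 = galConj τ.symm P.1 := ⟨⟨_, hR⟩, rfl⟩
    have hSR : S P = S R := hS τ.symm P R hRP
    have h1 := (hG.2 R (by
      rw [Finsupp.mem_support_iff, ← hSR]; exact Finsupp.mem_support_iff.mp hP)).galConj τ
    have h2 : galConj τ (galConj τ.symm P.1) = P.1 := galConj_symm_galConj τ.symm P.1
    rwa [← hSR, hRP, h2] at h1
  obtain ⟨G, h1, h2, h3⟩ := hf.exists_form_multGe S hd
  obtain ⟨Q, hQ0, hQ⟩ := exists_map_mem_of_stable W hstable ⟨G, ⟨h1, h3⟩, h2⟩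
  have hQd : Q.IsHomogeneous d := IsHomogeneous.of_map (algebraMap k K).injective hQ.1
  exact ⟨Q, hQd, hQ0, (hf.interGe_iff hQd S).mpr hQ.2⟩

end Galois

/-! ### The interpolation step -/

section Interpolation

/-- By the Chinese remainder theorem, the multiples of `F` that are needed for the single ideals can
be chosen to be the same. -/
theorem mem_sup_iInf_of_forall_mem_sup {R ι : Type*} [CommRing R] (s : Finset ι) {I : ι → Ideal R}
    (hI : ∀ i ∈ s, ∀ j ∈ s, i ≠ j → IsCoprime (I i) (I j)) {F G : R}
    (h : ∀ i ∈ s, G ∈ Ideal.span {F} ⊔ I i) : G ∈ Ideal.span {F} ⊔ ⨅ i ∈ s, I i := by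
  have h1 : ∀ i : s, ∃ b : R, G - b * F ∈ I i := fun i => by
    obtain ⟨x, hx, y, hy, e⟩ := Submodule.mem_sup.mp (h i i.2)
    obtain ⟨b, rfl⟩ := Ideal.mem_span_singleton.mp hx
    exact ⟨b, by rwa [← e, mul_comm b, add_sub_cancel_left]⟩
  choose b hb using h1
  have hco : Pairwise (Function.onFun IsCoprime fun i : s => I i) := fun i j hij =>
    hI i i.2 j j.2 fun h' => hij (Subtype.ext h')
  obtain ⟨r, hr⟩ := Ideal.exists_forall_sub_mem_ideal hco b
  refine Submodule.mem_sup.mpr ⟨r * F, Ideal.mul_mem_left _ _ (Ideal.mem_span_singleton_self F),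
    G - r * F, ?_, add_sub_cancel _ _⟩
  simp only [Submodule.mem_iInf]
  intro i hi
  have e : G - r * F = (G - b ⟨i, hi⟩ * F) - (r - b ⟨i, hi⟩) * F := by ring
  rw [e]
  exact Ideal.sub_mem _ (hb ⟨i, hi⟩) (Ideal.mul_mem_right _ _ (hr ⟨i, hi⟩))

theorem totalDegree_dehom_le {K : Type*} [Field K] (i : Fin 3) {H : MvPolynomial (Fin 3) K} {d : ℕ}
    (hH : H.IsHomogeneous d) : (dehom i H).totalDegree ≤ d := by
  rw [dehom, aeval_def, eval₂_eq]
  refine totalDegree_finsetSum_le fun m hm => ?_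
  refine (totalDegree_mul _ _).trans ?_
  rw [MvPolynomial.algebraMap_eq, totalDegree_C, zero_add]
  refine (totalDegree_finsetProd _ _).trans ?_
  have hmd : m.degree = d := by
    by_contra h
    exact (mem_support_iff.mp hm) (hH.coeff_eq_zero h)
  rw [← hmd, Finsupp.degree_apply]
  refine Finset.sum_le_sum fun j _ => (totalDegree_pow _ _).trans ?_
  refine (Nat.mul_le_mul_left _ (?_ : _ ≤ 1)).trans (mul_one _).le
  rcases Fin.eq_self_or_eq_succAbove i j with rfl | ⟨j, rfl⟩
  · rw [Fin.insertNth_apply_same]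
    simp
  · rw [Fin.insertNth_apply_succAbove, totalDegree_X]

variable {k K : Type*} [Field k] [Field K] [Algebra k K] {f : MvPolynomial (Fin 3) k}
  {M : Matrix (Fin 3) (Fin 3) k}

theorem map_linSubst (M : Matrix (Fin 3) (Fin 3) k) (q : MvPolynomial (Fin 3) k) :
    map (algebraMap k K) (linSubst M q) =
      linSubst (M.map (algebraMap k K)) (map (algebraMap k K) q) := by
  rw [linSubst, linSubst, map_bind₁]
  congr 2
  funext i
  simp

theorem map_mulVec_newCoords (hM : IsUnit M.det) (P : ℙ K (Fin 3 → K)) :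
    M.map (algebraMap k K) *ᵥ newCoords M P = P.rep := by
  rw [newCoords, Matrix.mulVec_mulVec, ← Matrix.map_mul, Matrix.mul_nonsing_inv _ hM,
    Matrix.map_one _ (map_zero _) (map_one _), Matrix.one_mulVec]

theorem isUnit_det_map (hM : IsUnit M.det) : IsUnit (M.map (algebraMap k K)).det := by
  have := hM.map (algebraMap k K)
  rwa [RingHom.map_det] at this

theorem newCoords_ne_zero (hM : IsUnit M.det) (P : ℙ K (Fin 3 → K)) : newCoords M P ≠ 0 :=
  fun h => P.rep_nonzero (by rw [← map_mulVec_newCoords hM P, h, Matrix.mulVec_zero])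

theorem linSubst_linSubst_inv (hM : IsUnit M.det) (q : MvPolynomial (Fin 3) k) :
    linSubst M (linSubst M⁻¹ q) = q := by
  rw [linSubst_linSubst, Matrix.nonsing_inv_mul _ hM, linSubst_one]

theorem linSubst_inv_linSubst (hM : IsUnit M.det) (q : MvPolynomial (Fin 3) k) :
    linSubst M⁻¹ (linSubst M q) = q := by
  rw [linSubst_linSubst, Matrix.mul_nonsing_inv _ hM, linSubst_one]

/-- The order of vanishing of a form along the curve does not depend on the coordinates. -/
theorem multGe_newCoords_iff (hM : IsUnit M.det) (q : MvPolynomial (Fin 3) k)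
    (P : ℙ K (Fin 3 → K)) (n : ℕ) :
    MultGe (map (algebraMap k K) (linSubst M f)) (map (algebraMap k K) q) (newCoords M P) n ↔
      MultGe (map (algebraMap k K) f) (map (algebraMap k K) (linSubst M⁻¹ q)) P.rep n := by
  conv_lhs => rw [← linSubst_linSubst_inv hM q]
  rw [map_linSubst, map_linSubst M, multGe_linSubst_iff (isUnit_det_map hM),
    map_mulVec_newCoords hM]

theorem eval_newCoords (hM : IsUnit M.det) (P : CurvePoint K f) :
    eval (newCoords M P.1) (map (algebraMap k K) (linSubst M f)) = 0 := by
  rw [map_linSubst, eval_linSubst, map_mulVec_newCoords hM, P.eval_eq_zero]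

theorem span_eq_pointIdeal (v : Fin 3 → K) :
    Ideal.span {X 0 - C (v 0 / v 2), X 1 - C (v 1 / v 2)} = pointIdeal (affinePt 2 v) := by
  rw [pointIdeal_eq_span]
  congr 1
  ext p
  simp only [Set.mem_insert_iff, Set.mem_singleton_iff, Set.mem_range, Fin.exists_fin_two]
  simp [affinePt, Fin.succAbove, eq_comm]

theorem interpolationIdeal_eq (S : CurvePoint K f →₀ ℕ) :
    interpolationIdeal f S M = Ideal.span {dehom 2 (map (algebraMap k K) (linSubst M f))} ⊔
      ⨅ P ∈ S.support, pointIdeal (affinePt 2 (newCoords M P.1)) ^ S P := by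
  simp only [interpolationIdeal, span_eq_pointIdeal]

theorem affinePt_newCoords_ne (hM : IsUnit M.det) {P P' : CurvePoint K f}
    (hP : newCoords M P.1 2 ≠ 0) (hP' : newCoords M P'.1 2 ≠ 0) (hne : P ≠ P') :
    affinePt 2 (newCoords M P.1) ≠ affinePt 2 (newCoords M P'.1) := fun h =>
  hne (Subtype.ext (eq_of_affinePt_eq
    (isUnit_det_map (Matrix.isUnit_nonsing_inv_det M hM)) hP hP' h))

variable (hf : IsSmoothPlaneQuartic K f) {S : CurvePoint K f →₀ ℕ}

include hf

/-- Every result of the interpolation step meets the curve in a divisor containing `S`. -/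
theorem IsSmoothPlaneQuartic.interGe_of_isInterpolationResult {Q : MvPolynomial (Fin 3) k}
    (hQ : IsInterpolationResult f S Q) : Q.IsHomogeneous 2 ∧ Q ≠ 0 ∧ InterGe f Q S := by
  obtain ⟨M, hM, hz, q, rfl, hq⟩ := hQ
  have hM' : IsUnit (M⁻¹).det := Matrix.isUnit_nonsing_inv_det M hM
  have hg : (map (algebraMap k K) (linSubst M f)).IsHomogeneous 4 :=
    (isHomogeneous_linSubst M hf.1).map _
  rcases hq with ⟨hS2, hqd, hq0, h⟩ | ⟨-, hqd, hqt, h⟩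
  · refine ⟨isHomogeneous_linSubst _ hqd, linSubst_ne_zero hM' hq0,
      (hf.interGe_iff (isHomogeneous_linSubst _ hqd) S).mpr fun P hP => ?_⟩
    rw [← multGe_newCoords_iff hM]
    have h0 := eval_newCoords hM P
    obtain ⟨h1, h2⟩ := h P hP
    rw [← eval_map_algebraMap] at h1
    have h3 : S P = 1 ∨ S P = 2 := by
      have := hS2 P
      have := Finsupp.mem_support_iff.mp hP
      omega
    rcases h3 with h3 | h3
    · rw [h3]
      exact multGe_one hg (hqd.map _) (newCoords_ne_zero hM P.1) h1
    · rw [h3]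
      refine multGe_two hg (hqd.map _) (newCoords_ne_zero hM P.1) h0 h1 ?_ fun i j => ?_
      · rw [map_linSubst]
        refine exists_pderiv_linSubst_ne_zero (isUnit_det_map hM) ?_
        rw [map_mulVec_newCoords hM]
        exact hf.isSmoothForm _ P.1.rep_nonzero P.eval_eq_zero
      · have := h2 h3 i j
        simpa only [pderiv_map, eval_map_algebraMap] using this
  · have hq0 : q ≠ 0 := by
      rintro rfl
      rw [dehom, map_zero, totalDegree_zero] at hqt
      exact absurd hqt (by norm_num)
    refine ⟨isHomogeneous_linSubst _ hqd, linSubst_ne_zero hM' hq0,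
      (hf.interGe_iff (isHomogeneous_linSubst _ hqd) S).mpr fun P hP => ?_⟩
    rw [← multGe_newCoords_iff hM]
    refine multGe_of_dehom_mem (hz P hP) hg (hqd.map _) ?_
    rw [interpolationIdeal_eq] at h
    obtain ⟨a, ha, b, hb, e⟩ := Submodule.mem_sup.mp h
    simp only [Submodule.mem_iInf] at hb
    exact Submodule.mem_sup.mpr ⟨a, ha, b, hb P hP, e⟩

/-- A quadratic form which meets the curve in enough points is not divisible by the equation of a
line that avoids these points. -/
theorem IsSmoothPlaneQuartic.totalDegree_dehom_eq_two [IsAlgClosed K] (hM : IsUnit M.det)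
    (hz : ∀ P ∈ S.support, newCoords M P.1 2 ≠ 0) (hS : 4 < S.degree)
    {q : MvPolynomial (Fin 3) k} (hqd : q.IsHomogeneous 2) (hq0 : q ≠ 0)
    (hq : InterGe f (linSubst M⁻¹ q) S) : (dehom 2 q).totalDegree = 2 := by
  refine le_antisymm (totalDegree_dehom_le 2 hqd) ?_
  by_contra! hlt
  obtain ⟨ℓ, hℓ, e⟩ := exists_isHomogeneous_dehom_eq 2 (dehom 2 q) (Nat.lt_succ_iff.mp hlt)
  have hq' : q = X 2 * ℓ := by
    rw [← sub_eq_zero]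
    refine eq_zero_of_dehom_eq_zero 2 (hqd.sub ((isHomogeneous_X _ _).mul hℓ)) ?_
    have h2 : dehom 2 (X 2 : MvPolynomial (Fin 3) k) = 1 := by
      rw [dehom, aeval_X, Fin.insertNth_apply_same]
    rw [dehom, map_sub, map_mul, ← dehom, ← dehom, ← dehom, h2, e, one_mul, sub_self]
  have hM' : IsUnit (M⁻¹).det := Matrix.isUnit_nonsing_inv_det M hM
  have hℓ0 : ℓ ≠ 0 := fun h => hq0 (by rw [hq', h, mul_zero])
  have hℓ' := isHomogeneous_linSubst M⁻¹ hℓ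
  obtain ⟨A, hA, hAd⟩ := hf.exists_interEq hℓ' (linSubst_ne_zero hM' hℓ0) (by norm_num)
  -- The line `ℓ` contains `S`, as `z` does not vanish at the points of `S`.
  have hle : S ≤ A := fun P => by
    by_cases hP : P ∈ S.support
    · have h1 := (hf.interGe_iff (isHomogeneous_linSubst _ hqd) S).mp hq P hP
      rw [← multGe_newCoords_iff hM, hq', map_mul, map_X] at h1
      have h2 := h1.of_mul_left (isHomogeneous_X _ _) (by rw [eval_X]; exact hz P hP)
      rw [multGe_newCoords_iff hM, ← hf.le_multAt_iff hℓ', hA P, Nat.cast_le] at h2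
      exact h2
    · rw [Finsupp.notMem_support_iff.mp hP]
      exact Nat.zero_le _
  have := Finsupp.degree_mono hle
  omega

/-- The interpolation step can be carried out: a quadratic form through `S` exists by a dimension
count, and it is a possible result of the method that applies to `S`. -/
theorem IsSmoothPlaneQuartic.exists_isInterpolationResult [IsGalois k K] [IsAlgClosed K]
    (hS : GaloisStable S) (hd : S.degree = 5) (hk : Infinite k ∨ 10 < Nat.card k) :
    ∃ Q, IsInterpolationResult f S Q := by
  classical
  obtain ⟨Q, hQd, hQ0, hQ⟩ := hf.exists_interGe hS (d := 2) (by
    rw [hd]; decide)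
  have hcard : S.support.card ≤ 5 := by
    rw [← hd, Finsupp.degree_apply, Finset.card_eq_sum_ones]
    exact Finset.sum_le_sum fun P hP => Nat.one_le_iff_ne_zero.mpr (Finsupp.mem_support_iff.mp hP)
  obtain ⟨t, ht⟩ := exists_line_avoiding (k := k) (S.support.image fun P => P.1.rep) (fun v hv => by
    obtain ⟨P, -, rfl⟩ := Finset.mem_image.mp hv
    exact P.1.rep_nonzero) (hk.imp_right fun h => by
      have := (Finset.card_image_le (s := S.support) (f := fun P => P.1.rep))
      omega)
  have hN := isUnit_det_lineMatrix t
  have hM : IsUnit ((lineMatrix t)⁻¹).det := Matrix.isUnit_nonsing_inv_det _ hN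
  set M := (lineMatrix t)⁻¹ with hMdef
  have hMinv : M⁻¹ = lineMatrix t := Matrix.nonsing_inv_nonsing_inv _ hN
  have hz : ∀ P ∈ S.support, newCoords M P.1 2 ≠ 0 := fun P hP => by
    have e : (lineMatrix t).map (algebraMap k K) = lineMatrix (algebraMap k K t) := by
      ext i j
      fin_cases i <;> fin_cases j <;> simp [lineMatrix]
    rw [newCoords, hMinv, e, lineMatrix_mulVec]
    exact ht _ (Finset.mem_image_of_mem _ hP)
  have hqd := isHomogeneous_linSubst M hQd
  have hq0 := linSubst_ne_zero hM hQ0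
  have hQq : Q = linSubst M⁻¹ (linSubst M Q) := (linSubst_inv_linSubst hM Q).symm
  have hQ' := (hf.interGe_iff hQd S).mp hQ
  have hmult : ∀ P ∈ S.support, MultGe (map (algebraMap k K) (linSubst M f))
      (map (algebraMap k K) (linSubst M Q)) (newCoords M P.1) (S P) := fun P hP => by
    rw [multGe_newCoords_iff hM, ← hQq]
    exact hQ' P hP
  refine ⟨Q, M, hM, hz, linSubst M Q, hQq, ?_⟩
  by_cases hS2 : ∀ P, S P ≤ 2
  · refine Or.inl ⟨hS2, hqd, hq0, fun P hP => ⟨?_, fun h2 i j => ?_⟩⟩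
    · rw [← eval_map_algebraMap]
      exact (hmult P hP).eval_eq_zero (eval_newCoords hM P) (Finsupp.mem_support_iff.mp hP)
    · have h1 := hmult P hP
      rw [h2] at h1
      have := h1.gradient_proportional (eval_newCoords hM P) i j
      simpa only [pderiv_map, eval_map_algebraMap] using this
  · refine Or.inr ⟨hS2, hqd, hf.totalDegree_dehom_eq_two hM hz (by omega) hqd hq0
      (hQq ▸ hQ), ?_⟩
    rw [interpolationIdeal_eq]
    refine mem_sup_iInf_of_forall_mem_sup _ (fun P hP P' hP' hne => ?_) fun P hP =>
      (hmult P hP).dehom_mem (hz P hP)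
    refine IsCoprime.pow (Ideal.isCoprime_of_isMaximal fun h => ?_)
    exact affinePt_newCoords_ne hM (hz P hP) (hz P' hP') hne (pointIdeal_injective h)

end Interpolation

/-! ### The residual divisor and the Jacobian -/

section Inversion

variable {k K : Type*} [Field k] [Field K] [Algebra k K] {f : MvPolynomial (Fin 3) k}

theorem interEq_unique {G : MvPolynomial (Fin 3) k} {A B : CurvePoint K f →₀ ℕ}
    (hA : InterEq f G A) (hB : InterEq f G B) : A = B :=
  Finsupp.ext fun P => Nat.cast_injective (R := ℕ∞) ((hA P).symm.trans (hB P))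

variable (hf : IsSmoothPlaneQuartic K f)

include hf

theorem IsSmoothPlaneQuartic.interEq_mul {G H : MvPolynomial (Fin 3) k}
    {A B : CurvePoint K f →₀ ℕ} (hA : InterEq f G A) (hB : InterEq f H B) :
    InterEq f (G * H) (A + B) := fun P => by
  have h := interMult_mul hf.isHomogeneous hf.isSmoothForm P.eval_eq_zero
    (map (algebraMap k K) G) (map (algebraMap k K) H)
  rw [multAt, map_mul, h, Finsupp.add_apply, Nat.cast_add, ← hA P, ← hB P]
  rfl

theorem IsSmoothPlaneQuartic.existsUnique_residual [IsAlgClosed K] {Q : MvPolynomial (Fin 3) k}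
    {n : ℕ} (hQ : Q.IsHomogeneous n) (hQ0 : Q ≠ 0) (hn : n < 4) {S : CurvePoint K f →₀ ℕ}
    (hS : InterGe f Q S) : ∃! E : CurvePoint K f →₀ ℕ, InterEq f Q (S + E) := by
  obtain ⟨A, hA, -⟩ := hf.exists_interEq hQ hQ0 hn
  have hle : S ≤ A := fun P => by
    have := hS P
    rwa [hA P, Nat.cast_le] at this
  refine ⟨A - S, ?_, fun E hE => ?_⟩
  · change InterEq f Q (S + (A - S))
    rwa [add_tsub_cancel_of_le hle]
  · rw [interEq_unique hA hE, add_tsub_cancel_left]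

theorem IsSmoothPlaneQuartic.degree_of_interEq [IsAlgClosed K] {Q : MvPolynomial (Fin 3) k}
    {n : ℕ} (hQ : Q.IsHomogeneous n) (hQ0 : Q ≠ 0) (hn : n < 4) {A : CurvePoint K f →₀ ℕ}
    (hA : InterEq f Q A) : A.degree = 4 * n := by
  obtain ⟨B, hB, hBd⟩ := hf.exists_interEq hQ hQ0 hn
  rw [interEq_unique hA hB, hBd]

end Inversion

theorem toDiv_sub_mem_ratDivZero {k K : Type*} [Field k] [Field K] [Algebra k K]
    {f : MvPolynomial (Fin 3) k} {D E : CurvePoint K f →₀ ℕ} (hD : GaloisStable D)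
    (hE : GaloisStable E) (h : D.degree = E.degree) : toDiv D - toDiv E ∈ ratDivZero K f := by
  refine ⟨fun σ P P' hP => ?_, ?_⟩
  · rw [Finsupp.sub_apply, Finsupp.sub_apply, hD.toDiv σ P P' hP, hE.toDiv σ P P' hP]
  · rw [map_sub, degree_toDiv, degree_toDiv, h, sub_self]

theorem isGalois_of_isAlgClosure (k K : Type*) [Field k] [PerfectField k] [Field K] [Algebra k K]
    [IsAlgClosure k K] : IsGalois k K := by
  have := IsAlgClosure.isAlgebraic (R := k) (K := K)
  have := IsAlgClosure.normal k K
  exact ⟨⟩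

end

theorem mainTheorem7 {k K : Type*} [Field k] [Finite k] [Field K] [Algebra k K] [IsAlgClosure k K]
    (p : ℕ) [CharP k p] (hp : 127 < p)
    (f : MvPolynomial (Fin 3) k) (hf : IsSmoothPlaneQuartic K f)
    (l : MvPolynomial (Fin 3) k) (hl : l.IsHomogeneous 1)
    (P₁ P₂ P₃ P₄ : CurvePoint K f)
    (hP₁ : IsRationalPoint k P₁.1) (hP₂ : IsRationalPoint k P₂.1)
    (hP₃ : IsRationalPoint k P₃.1) (hP₄ : IsRationalPoint k P₄.1)
    (hlC : InterEq f l (Finsupp.single P₁ 1 + Finsupp.single P₂ 1 + Finsupp.single P₃ 1 +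
      Finsupp.single P₄ 1))
    (Dinf : CurvePoint K f →₀ ℕ)
    (hDinf : Dinf = Finsupp.single P₁ 1 + Finsupp.single P₂ 1 + Finsupp.single P₃ 1)
    (D : CurvePoint K f →₀ ℕ) (hD : GaloisStable D) (hDdeg : D.degree = 3)
    (S : CurvePoint K f →₀ ℕ) (hS : S = D + Finsupp.single P₄ 2) :
    (∃ Q, IsInterpolationResult f S Q) ∧
    (∀ Q, IsInterpolationResult f S Q → Q.IsHomogeneous 2 ∧ Q ≠ 0 ∧ InterGe f Q S) ∧
    (∀ Q : MvPolynomial (Fin 3) k, Q.IsHomogeneous 2 → Q ≠ 0 → InterGe f Q S →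
      (∃! E : CurvePoint K f →₀ ℕ, InterEq f Q (S + E)) ∧
      ∀ E : CurvePoint K f →₀ ℕ, InterEq f Q (S + E) →
        GaloisStable E ∧ E.degree = 3 ∧
        (∃ B : CurvePoint K f →₀ ℕ, InterEq f (l ^ 2) B ∧
          (toDiv D - toDiv Dinf) + (toDiv E - toDiv Dinf) = toDiv (S + E) - toDiv B) ∧
        ∃ (hD₀ : toDiv D - toDiv Dinf ∈ ratDivZero K f)
          (hE₀ : toDiv E - toDiv Dinf ∈ ratDivZero K f),
          Jac.mk (toDiv E - toDiv Dinf) hE₀ = -Jac.mk (toDiv D - toDiv Dinf) hD₀) := by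
  have := IsAlgClosure.isAlgClosed k (K := K)
  have := isGalois_of_isAlgClosure k K
  have hcard : p ≤ Nat.card k := by
    have := Fintype.ofFinite k
    rw [Nat.card_eq_fintype_card]
    exact Nat.le_of_dvd Fintype.card_pos ((CharP.cast_eq_zero_iff k p _).mp (Nat.cast_card_eq_zero k))
  have hSst : GaloisStable S := hS ▸ hD.add (GaloisStable.single hP₄ 2)
  have hSdeg : S.degree = 5 := by
    rw [hS, map_add, hDdeg, Finsupp.degree_single]
  have hDinfst : GaloisStable Dinf := hDinf ▸
    ((GaloisStable.single hP₁ 1).add (GaloisStable.single hP₂ 1)).add (GaloisStable.single hP₃ 1)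
  have hDinfdeg : Dinf.degree = 3 := by
    simp only [hDinf, map_add, Finsupp.degree_single]
  refine ⟨hf.exists_isInterpolationResult hSst hSdeg (Or.inr (by omega)),
    fun Q hQ => hf.interGe_of_isInterpolationResult hQ, fun Q hQd hQ0 hQ =>
    ⟨hf.existsUnique_residual hQd hQ0 (by norm_num) hQ, fun E hE => ?_⟩⟩
  have hEst : GaloisStable E := hSst.of_add_left (hf.galoisStable_of_interEq hQd hE)
  have hEdeg : E.degree = 3 := by
    have := hf.degree_of_interEq hQd hQ0 (by norm_num) hE
    rw [map_add, hSdeg] at this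
    omega
  rw [← hDinf] at hlC
  have hB : InterEq f (l ^ 2) ((Dinf + Finsupp.single P₄ 1) + (Dinf + Finsupp.single P₄ 1)) := by
    rw [pow_two]
    exact hf.interEq_mul hlC hlC
  have hsum : (toDiv D - toDiv Dinf) + (toDiv E - toDiv Dinf) = toDiv (S + E) -
      toDiv ((Dinf + Finsupp.single P₄ 1) + (Dinf + Finsupp.single P₄ 1)) := by
    have h2 : (Finsupp.single P₄ 2 : CurvePoint K f →₀ ℕ) =
        Finsupp.single P₄ 1 + Finsupp.single P₄ 1 := by rw [← Finsupp.single_add]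
    rw [hS, h2]
    simp only [toDiv_add]
    abel
  have hD₀ := toDiv_sub_mem_ratDivZero hD hDinfst (hDdeg.trans hDinfdeg.symm)
  have hE₀ := toDiv_sub_mem_ratDivZero hEst hDinfst (hEdeg.trans hDinfdeg.symm)
  refine ⟨hEst, hEdeg, ⟨_, hB, hsum⟩, hD₀, hE₀, ?_⟩
  rw [eq_neg_iff_add_eq_zero, add_comm, Jac.mk, Jac.mk, ← QuotientAddGroup.mk_add,
    QuotientAddGroup.eq_zero_iff, AddSubgroup.mem_addSubgroupOf]
  exact AddSubgroup.subset_closure ⟨2, Q, l ^ 2, _, _, hQd, by simpa using hl.pow 2, hE, hB, hsum⟩
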